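/- All graphs are finite, simple and undirected; $N(v)$ denotes the neighbourhood of $v$ in $G$, and $N(X)=\bigcup_{v\in X}N(v)$. The treedepth of a graph $G$ is the minimum height of an elimination forest of $G$, that is, of a rooted forest on the vertex set $V(G)$ such that the two ends of every edge of $G$ lie on a common root-to-leaf path; the height is the maximum number of vertices on a root-to-leaf path. **Definitions.** - The fan $F_n$ is obtained from a path on $n$ vertices by adding a new vertex (the centre) adjacent to all vertices of the path; its poles are the centre and the two ends of the path. A graph $G$ contains a *protected fan on $n$ vertices* if there is $Q\subseteq V(G)$ and an isomorphism between $F_{n-1}$ and $G[Q]$ such that $N(v)\subseteq Q$ for every $v\in Q$ that does not correspond to a pole. - A subgraph $G'$ of $G$ is an *$L$-type subgraph* with treedepth bound $c\ge 1$ and length bound $\ell\ge 1$ if $G'$ has treedepth at most $c$ and there is a set $S=\{s,t\}\subseteq V(G)\setminus V(G')$ of two distinct vertices such that $N(V(G'))\setminus V(G')=S$, $|N(v)\cap (V(G')\cup S)|\ge 2$ for each $v\in S$, and $G[V(G')\cup S]$ contains an induced path with at least $\ell$ edges from $s$ to $t$. - For $m,k\ge 1$, $\mathbb{H}_m^{1,k,k,k}$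 is the tree consisting of a path with $m$ edges with end-vertices $u\ne v$, two further paths starting at $u$, with $1$ and $k$ edges, and two further paths starting at $v$, each with $k$ edges, where these five paths are disjoint except for the shared vertices $u$ and $v$. **Theorem.** For all integers $k,m\ge 1$ there is a number $c(k,m)$ such that every graph $G$ with minimum degree at least $3$ and treedepth at least $c(k,m)$ contains at least one of the following: 1. a protected fan on $m+k+2$ vertices; 2. an induced subgraph $G'$ of $G$ that is an $L$-type subgraph with treedepth bound $(4k-3)(8k^2-6k+2m+8)-1$ and length bound $m+k$; 3. a (not necessarily induced) subgraph isomorphic to $\mathbb{H}_m^{1,k,k,k}$. -/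

import Mathlib

/-- An elimination forest of `G`, given by the ancestor order `le` of a rooted forest on the
vertex set of `G` (`le u v` says that `u` is `v` or an ancestor of `v`). On a finite set, the
ancestor orders of rooted forests are exactly the partial orders in which the elements below any
given element form a chain, and two vertices lie on a common root-to-leaf path iff they are
comparable. -/
structure EliminationForest {V : Type*} (G : SimpleGraph V) where
  le : V → V → Prop
  le_refl : ∀ v, le v v
  le_trans : ∀ u v w, le u v → le v w → le u w
  le_antisymm : ∀ u v, le u v → le v u → u = v
  ancestors_chain : ∀ u v w, le u w → le v w → le u v ∨ le v u
  adj_comparable : ∀ u v, G.Adj u v → le u v ∨ le v u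

/-- The height of an elimination forest on a finite vertex set: the largest number of vertices on
a path from a root to a vertex. -/
noncomputable def EliminationForest.height {V : Type*} {G : SimpleGraph V}
    (F : EliminationForest G) : ℕ :=
  ⨆ v : V, {u : V | F.le u v}.ncard

/-- The treedepth of a finite graph: the minimum height of an elimination forest
(so that the one-vertex graph has treedepth `1`). -/
noncomputable def treedepth {V : Type*} (G : SimpleGraph V) : ℕ :=
  ⨅ F : EliminationForest G, F.height

/-- Every graph has an elimination forest, so the minimum in `treedepth` is over a nonempty set. -/
theorem EliminationForest.nonempty {V : Type*} (G : SimpleGraph V) :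
    Nonempty (EliminationForest G) := by
  obtain ⟨o⟩ : Nonempty (LinearOrder V) := by
    classical exact ⟨linearOrderOfSTO (WellOrderingRel (α := V))⟩
  exact ⟨⟨fun a b => a ≤ b, fun v => _root_.le_refl v, fun _ _ _ h h' => _root_.le_trans h h',
    fun _ _ h h' => _root_.le_antisymm h h', fun u v _ _ _ => le_total u v,
    fun u v _ => le_total u v⟩⟩

/-- The fan `F_n`: a path on `n` vertices (the vertices `some i`) together with a centre `none`
adjacent to all of them. -/
def fanGraph (n : ℕ) : SimpleGraph (Option (Fin n)) :=
  SimpleGraph.fromRel fun x y =>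
    match x, y with
    | none, some _ => True
    | some i, some j => (SimpleGraph.pathGraph n).Adj i j
    | _, none => False

/-- The poles of the fan `F_n`: its centre and the two ends of its path. -/
def IsFanPole {n : ℕ} : Option (Fin n) → Prop
  | none => True
  | some i => i.val = 0 ∨ i.val + 1 = n

/-- `G` contains a protected fan of order `n`: a vertex set `Q` inducing a copy of `F_{n-1}` such
that every vertex of `Q` that is not a pole has all its neighbours in `Q`. -/
def ContainsProtectedFan {V : Type*} (G : SimpleGraph V) (n : ℕ) : Prop :=
  ∃ (Q : Set V) (e : fanGraph (n - 1) ≃g G.induce Q),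
    ∀ x, ¬ IsFanPole x → G.neighborSet (e x : V) ⊆ Q

/-- The vertices of the subdivided "H"-graph: the horizontal path has `i` edges, and the four legs
have `a`, `b`, `c`, `d` vertices. -/
inductive HVertex (i a b c d : ℕ) : Type
  | spine (x : Fin (i + 1))
  | legA (x : Fin a)
  | legB (x : Fin b)
  | legC (x : Fin c)
  | legD (x : Fin d)

/-- The subdivided "H"-graph with a horizontal path of `i ≥ 1` edges, two legs with `a` and `b`
edges at the first vertex of the horizontal path and two legs with `c` and `d` edges at its last
vertex. (The first vertex of each leg is the one next to the horizontal path.) -/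
def subdividedH (i a b c d : ℕ) : SimpleGraph (HVertex i a b c d) :=
  SimpleGraph.fromRel fun u v =>
    match u, v with
    | .spine x, .spine y => x.val + 1 = y.val
    | .spine x, .legA y => x.val = 0 ∧ y.val = 0
    | .spine x, .legB y => x.val = 0 ∧ y.val = 0
    | .spine x, .legC y => x.val = i ∧ y.val = 0
    | .spine x, .legD y => x.val = i ∧ y.val = 0
    | .legA x, .legA y => x.val + 1 = y.val
    | .legB x, .legB y => x.val + 1 = y.val
    | .legC x, .legC y => x.val + 1 = y.val
    | .legD x, .legD y => x.val + 1 = y.val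
    | _, _ => False

/-- `S` is a witness set for the subgraph `G'` of `G`: it is a set of at most two vertices outside
`G'`, it is the set of all vertices outside `G'` with a neighbour in `G'`, and each of its vertices
has at least two neighbours in `V(G') ∪ S`. Neighbourhoods are taken in `G`. -/
def IsWitnessSet {V : Type*} (G : SimpleGraph V) (G' : G.Subgraph) (S : Set V) : Prop :=
  Disjoint S G'.verts ∧ S.ncard ≤ 2 ∧
    (⋃ v ∈ G'.verts, G.neighborSet v) \ G'.verts = S ∧
    ∀ v ∈ S, 2 ≤ (G.neighborSet v ∩ (G'.verts ∪ S)).ncard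

/-- `G'` is an `L`-type subgraph of `G` with treedepth bound `c` and length bound `l`: it has
treedepth at most `c` and a witness set `S = {s, t}` of size two such that `G[V(G') ∪ S]` contains
an induced path of length at least `l` from `s` to `t`. -/
def IsLType {V : Type*} (G : SimpleGraph V) (G' : G.Subgraph) (c l : ℕ) : Prop :=
  treedepth G'.coe ≤ c ∧
    ∃ s t : V, s ≠ t ∧ IsWitnessSet G G' {s, t} ∧
      ∃ p : G.Walk s t, p.IsPath ∧ p.toSubgraph.IsInduced ∧
        (∀ v ∈ p.support, v ∈ G'.verts ∪ {s, t}) ∧ l ≤ p.length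

-- A depth-first search forest is no higher than a longest path, so large treedepth forces a long
-- path. The Ramsey argument of `exists_inducedPath_or_biclique` turns it into a long induced path
-- `p 0, …, p N` or a large complete bipartite subgraph; the latter contains the tree H, which is
-- bipartite. On the induced path, minimum degree 3 gives every vertex a neighbour off the path. It
-- remains to study how the components of the graph minus the path attach to it, assuming that there
-- is no H.
--
-- Suppose a component attaches at two places at distance at least `2 * k`. Then one vertex `y` of
-- it is forced to be the only outer neighbour of path vertices further along: `eq_of_handle`
-- propagates this by steps of `m`, `outer_nbr_unique_of_high` by steps of `m - 1`. Together these
-- steps reach every sufficiently distant index, which gives a protected fan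
-- (`containsProtectedFan_of_far`). So, without a protected fan, a component attaching in the middle
-- of the path attaches only locally (`attaches_near`).
--
-- If every vertex of a window were straddled by some component, a greedy chain of such components
-- would give two disjoint paths running left (`exists_two_legs`); with the path continuing to the
-- right they form H. Hence two distant windows contain unstraddled vertices, which are adjusted to
-- `p s` and `p t` (`exists_left_end`, `exists_right_end`). These two vertices separate from the
-- rest of the graph the inner part of the path with the components attaching only between them.
-- Each of these components is shallow, since a long path into it from its last attachment would be
-- a leg of H (`length_lt_of_last`). So this part has small treedepth and is the required L-type
-- subgraph.

universe u

/-! ### Depth-first search and upper bounds on treedepth. -/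

/-- Depth-first search: if every path starting in a chosen root of a component has at most `n`
vertices, then there is an elimination forest in which every vertex has at most `n` ancestors. -/
theorem EliminationForest.exists_of_root (n : ℕ) : ∀ {V : Type u} (G : SimpleGraph V) (r : V → V),
    (∀ v, G.Reachable v (r v)) → (∀ a b, G.Adj a b → r a = r b) →
    (∀ v w (p : G.Walk (r v) w), p.IsPath → p.length < n) →
    ∃ F : EliminationForest G, (∀ a b, F.le a b → G.Reachable a b) ∧
      ∀ v, {a | F.le a v}.encard ≤ n := by
  induction n with
  | zero =>
    intro V G r _ _ hp
    have hV : V → False := fun v => by simpa using hp v _ .nil (by simp)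
    exact ⟨⟨fun _ _ => True, fun v => (hV v).elim, fun v => (hV v).elim, fun v => (hV v).elim,
      fun v => (hV v).elim, fun v => (hV v).elim⟩, fun v => (hV v).elim, fun v => (hV v).elim⟩
  | succ n ih =>
    classical
    intro V G r hr hadj hp
    have hreach : ∀ {a b}, G.Reachable a b → r a = r b := by
      rintro a b ⟨w⟩
      induction w with
      | nil => rfl
      | cons h _ ih => exact (hadj _ _ h).trans ih
    have hrr : ∀ v, r (r v) = r v := fun v => (hreach (hr v)).symm
    let s : Set V := {v | r v ≠ v}
    -- A path from the root of the component to `w` meets no root again, so after its first edge it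
    -- stays in `s`; its second vertex is a child of the root.
    have key : ∀ w : s, ∃ y : s, (G.induce s).Reachable w y ∧ G.Adj (r w) y := by
      rintro ⟨w, hw⟩
      obtain ⟨ρ, hρ⟩ : ∃ ρ, r w = ρ := ⟨_, rfl⟩
      have hwρ := hr w
      simp only [hρ] at hwρ ⊢
      obtain ⟨p, hpp⟩ := hwρ.symm.exists_isPath
      cases p with
      | nil => exact absurd hρ hw
      | @cons _ y _ h q =>
        rw [SimpleGraph.Walk.cons_isPath_iff] at hpp
        have hs : ∀ x ∈ q.support, x ∈ s := by
          intro x hx hrx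
          have : r x = r w := hreach ⟨q.dropUntil x hx⟩
          exact hpp.2 (by rw [← hρ, ← this, hrx]; exact hx)
        exact ⟨⟨y, hs y q.start_mem_support⟩, (q.induce s hs).reachable.symm, h⟩
    have key2 : ∀ c : (G.induce s).ConnectedComponent, ∃ y : s,
        (G.induce s).connectedComponentMk y = c ∧ G.Adj (r y) y := by
      intro c
      induction c using SimpleGraph.ConnectedComponent.ind with | _ w
      obtain ⟨y, h1, h2⟩ := key w
      refine ⟨y, SimpleGraph.ConnectedComponent.sound h1.symm, ?_⟩
      have h3 : G.Reachable (w : V) (y : V) := h1.map (SimpleGraph.Embedding.induce s).toHom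
      rwa [← hreach h3]
    choose f hf hf' using key2
    -- Putting the old root in front of a path from a new root lengthens it by one; this is what
    -- lets the bound drop from `n + 1` to `n`.
    have aux : ∀ c w (p : (G.induce s).Walk (f c) w), p.IsPath → p.length < n := by
      intro c w p hpp
      let q : G.Walk (f c : V) (w : V) := p.map (SimpleGraph.Embedding.induce s).toHom
      have hq : q.IsPath := hpp.map (SimpleGraph.Embedding.induce (G := G) s).injective
      have hlen : q.length = p.length := SimpleGraph.Walk.length_map _ _
      have hsupp : q.support = p.support.map (SimpleGraph.Embedding.induce s).toHom :=
        SimpleGraph.Walk.support_map _ _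
      have := hp (f c) _ (SimpleGraph.Walk.cons (hf' c) q) (by
        rw [SimpleGraph.Walk.cons_isPath_iff]
        refine ⟨hq, fun h => ?_⟩
        rw [hsupp, List.mem_map] at h
        obtain ⟨z, _, hz⟩ := h
        have hz' : (z : V) = r (f c) := hz
        exact z.2 (by rw [hz', hrr]))
      rw [SimpleGraph.Walk.length_cons] at this
      omega
    obtain ⟨F, hF, hF'⟩ := ih (G.induce s) (fun w => f ((G.induce s).connectedComponentMk w))
      (fun v => SimpleGraph.ConnectedComponent.exact (hf _).symm)
      (fun a b h => by
        rw [SimpleGraph.ConnectedComponent.sound h.reachable])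
      (fun _ => aux _)
    have hFr : ∀ a b : s, F.le a b → G.Reachable (a : V) b := fun a b h =>
      (hF a b h).map (SimpleGraph.Embedding.induce s).toHom
    refine ⟨⟨fun a b => a = b ∨ (r a = a ∧ G.Reachable a b) ∨
        ∃ (ha : a ∈ s) (hb : b ∈ s), F.le ⟨a, ha⟩ ⟨b, hb⟩, fun _ => .inl rfl, ?_, ?_, ?_, ?_⟩,
        ?_, ?_⟩
    · rintro a b c (rfl | ⟨h, h'⟩ | ⟨ha, hb, h⟩) (rfl | ⟨g, g'⟩ | ⟨ga, gb, g⟩)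
      · simp
      · exact .inr (.inl ⟨g, g'⟩)
      · exact .inr (.inr ⟨ga, gb, g⟩)
      · exact .inr (.inl ⟨h, h'⟩)
      · exact .inr (.inl ⟨h, h'.trans g'⟩)
      · exact .inr (.inl ⟨h, h'.trans (hFr _ _ g)⟩)
      · exact .inr (.inr ⟨ha, hb, h⟩)
      · exact absurd g hb
      · exact .inr (.inr ⟨ha, gb, F.le_trans _ _ _ h g⟩)
    · rintro a b (rfl | ⟨h, h'⟩ | ⟨ha, hb, h⟩) (h2 | ⟨g, g'⟩ | ⟨ga, gb, g⟩)
      · rfl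
      · rfl
      · rfl
      · exact h2.symm
      · rw [← h, ← g, hreach h']
      · exact absurd h gb
      · exact h2.symm
      · exact absurd g hb
      · exact congrArg Subtype.val (F.le_antisymm _ _ h g)
    · rintro a b c (rfl | ⟨h, h'⟩ | ⟨ha, hb, h⟩) (rfl | ⟨g, g'⟩ | ⟨ga, gb, g⟩)
      · simp
      · exact .inr (.inr (.inl ⟨g, g'⟩))
      · exact .inr (.inr (.inr ⟨ga, gb, g⟩))
      · exact .inl (.inr (.inl ⟨h, h'⟩))
      · exact .inl (.inl (by rw [← h, ← g, hreach h', hreach g']))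
      · exact .inl (.inr (.inl ⟨h, h'.trans (hFr _ _ g).symm⟩))
      · exact .inl (.inr (.inr ⟨ha, hb, h⟩))
      · exact .inr (.inr (.inl ⟨g, g'.trans (hFr _ _ h).symm⟩))
      · exact (F.ancestors_chain _ _ _ h g).imp (fun h => .inr (.inr ⟨_, _, h⟩))
          (fun h => .inr (.inr ⟨_, _, h⟩))
    · intro a b h
      by_cases ha : r a = a
      · exact .inl (.inr (.inl ⟨ha, h.reachable⟩))
      by_cases hb : r b = b
      · exact .inr (.inr (.inl ⟨hb, h.symm.reachable⟩))
      exact (F.adj_comparable ⟨a, ha⟩ ⟨b, hb⟩ h).imp (fun h => .inr (.inr ⟨_, _, h⟩))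
          (fun h => .inr (.inr ⟨_, _, h⟩))
    · rintro a b (rfl | ⟨h, h'⟩ | ⟨ha, hb, h⟩)
      · rfl
      · exact h'
      · exact hFr _ _ h
    · intro v
      by_cases hv : r v = v
      · refine (Set.encard_le_encard (t := {v}) ?_).trans (by simp)
        rintro a (rfl | ⟨h, h'⟩ | ⟨ha, hb, h⟩)
        · rfl
        · exact show a = v by rw [← hv, ← h, hreach h']
        · exact absurd hv hb
      · refine (Set.encard_le_encard
          (t := insert (r v) (Subtype.val '' {a : s | F.le a ⟨v, hv⟩})) ?_).trans ?_
        · rintro a (rfl | ⟨h, h'⟩ | ⟨ha, hb, h⟩)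
          · exact .inr ⟨⟨a, hv⟩, F.le_refl _, rfl⟩
          · exact .inl (by rw [← h, hreach h'])
          · exact .inr ⟨⟨a, ha⟩, h, rfl⟩
        · refine (Set.encard_insert_le _ _).trans ?_
          rw [Subtype.val_injective.encard_image]
          push_cast
          gcongr
          exact hF' _

theorem treedepth_le_of_forest {V : Type*} {G : SimpleGraph V} {n : ℕ} (F : EliminationForest G)
    (h : ∀ v, {a | F.le a v}.encard ≤ n) : treedepth G ≤ n := by
  have hF : treedepth G ≤ F.height := Nat.sInf_le ⟨F, rfl⟩
  refine hF.trans ?_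
  refine ciSup_le' fun v => ?_
  have : {a | F.le a v}.Finite := Set.finite_of_encard_le_coe (h v)
  have h2 := h v
  rw [← this.cast_ncard_eq] at h2
  exact_mod_cast h2

/-- A graph of large treedepth contains a long path. -/
theorem exists_path_of_le_treedepth {V : Type u} {G : SimpleGraph V} {n : ℕ}
    (h : n + 1 ≤ treedepth G) : ∃ (a b : V) (p : G.Walk a b), p.IsPath ∧ n ≤ p.length := by
  by_contra! hcon
  let r : V → V := fun v => (G.connectedComponentMk v).out
  obtain ⟨F, -, hF⟩ := EliminationForest.exists_of_root n G r
    (fun v => SimpleGraph.ConnectedComponent.exact (Quot.out_eq (G.connectedComponentMk v)).symm)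
    (fun a b hab => by simp only [r]; rw [SimpleGraph.ConnectedComponent.sound hab.reachable])
    (fun v w p hp => hcon _ _ p hp)
  have := treedepth_le_of_forest F hF
  omega

/-- A set `X` of vertices can be put, linearly ordered, above an elimination
forest of the rest. -/
theorem treedepth_le_card_add {V : Type u} {G : SimpleGraph V} (X : Finset V) {n : ℕ}
    (F : EliminationForest (G.induce (X : Set V)ᶜ)) (h : ∀ v, {a | F.le a v}.encard ≤ n) :
    treedepth G ≤ X.card + n := by
  obtain ⟨o⟩ : Nonempty (LinearOrder V) := by
    classical exact ⟨linearOrderOfSTO (WellOrderingRel (α := V))⟩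
  let le : V → V → Prop := fun a b => (a ∈ X ∧ b ∈ X ∧ a ≤ b) ∨ (a ∈ X ∧ b ∉ X) ∨
    ∃ (ha : a ∉ X) (hb : b ∉ X), F.le ⟨a, ha⟩ ⟨b, hb⟩
  refine treedepth_le_of_forest ⟨le, ?_, ?_, ?_, ?_, ?_⟩ ?_
  · intro v
    by_cases hv : v ∈ X
    · exact .inl ⟨hv, hv, _root_.le_refl v⟩
    · exact .inr (.inr ⟨hv, hv, F.le_refl _⟩)
  · rintro a b c (⟨h1, h2, h3⟩ | ⟨h1, h2⟩ | ⟨h1, h2, h3⟩) (⟨g1, g2, g3⟩ | ⟨g1, g2⟩ | ⟨g1, g2, g3⟩)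
    · exact .inl ⟨h1, g2, _root_.le_trans h3 g3⟩
    · exact .inr (.inl ⟨h1, g2⟩)
    · exact absurd h2 g1
    · exact absurd g1 h2
    · exact absurd g1 h2
    · exact .inr (.inl ⟨h1, g2⟩)
    · exact absurd g1 h2
    · exact absurd g1 h2
    · exact .inr (.inr ⟨h1, g2, F.le_trans _ _ _ h3 g3⟩)
  · rintro a b (⟨h1, h2, h3⟩ | ⟨h1, h2⟩ | ⟨h1, h2, h3⟩) (⟨g1, g2, g3⟩ | ⟨g1, g2⟩ | ⟨g1, g2, g3⟩)
    · exact _root_.le_antisymm h3 g3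
    · exact absurd h1 g2
    · exact absurd h1 g2
    · exact absurd g1 h2
    · exact absurd g1 h2
    · exact absurd h1 g2
    · exact absurd g1 h2
    · exact absurd g1 h2
    · exact congrArg Subtype.val (F.le_antisymm _ _ h3 g3)
  · rintro a b c (⟨h1, h2, h3⟩ | ⟨h1, h2⟩ | ⟨h1, h2, h3⟩) (⟨g1, g2, g3⟩ | ⟨g1, g2⟩ | ⟨g1, g2, g3⟩)
    · exact (le_total a b).imp (fun h => .inl ⟨h1, g1, h⟩) (fun h => .inl ⟨g1, h1, h⟩)
    · exact absurd h2 g2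
    · exact absurd h2 g2
    · exact absurd g2 h2
    · exact (le_total a b).imp (fun h => .inl ⟨h1, g1, h⟩) (fun h => .inl ⟨g1, h1, h⟩)
    · exact .inl (.inr (.inl ⟨h1, g1⟩))
    · exact absurd g2 h2
    · exact .inr (.inr (.inl ⟨g1, h1⟩))
    · exact (F.ancestors_chain _ _ _ h3 g3).imp (fun h => .inr (.inr ⟨_, _, h⟩))
          (fun h => .inr (.inr ⟨_, _, h⟩))
  · intro a b hab
    by_cases ha : a ∈ X <;> by_cases hb : b ∈ X
    · exact (le_total a b).imp (fun h => .inl ⟨ha, hb, h⟩) (fun h => .inl ⟨hb, ha, h⟩)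
    · exact .inl (.inr (.inl ⟨ha, hb⟩))
    · exact .inr (.inr (.inl ⟨hb, ha⟩))
    · exact (F.adj_comparable ⟨a, ha⟩ ⟨b, hb⟩ hab).imp (fun h => .inr (.inr ⟨_, _, h⟩))
          (fun h => .inr (.inr ⟨_, _, h⟩))
  · intro v
    push_cast
    by_cases hv : v ∈ X
    · refine (Set.encard_le_encard (t := (X : Set V)) ?_).trans (by simp)
      rintro a (⟨h1, h2, h3⟩ | ⟨h1, h2⟩ | ⟨h1, h2, h3⟩)
      · exact h1
      · exact h1
      · exact absurd hv h2
    · refine (Set.encard_le_encard (t := (X : Set V) ∪ Subtype.val '' {a | F.le a ⟨v, hv⟩})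
        ?_).trans ((Set.encard_union_le _ _).trans ?_)
      · rintro a (⟨h1, h2, h3⟩ | ⟨h1, h2⟩ | ⟨h1, h2, h3⟩)
        · exact .inl h1
        · exact .inl h1
        · exact .inr ⟨⟨a, h1⟩, h3, rfl⟩
      · rw [Subtype.val_injective.encard_image, Set.encard_coe_eq_coe_finsetCard]
        gcongr
        exact h _

/-! ### Ramsey's theorem for finite sets. -/

/-- Ramsey's theorem for colourings of increasing lists of length `r`. -/
theorem exists_monochromatic_lists {κ : Type*} [Finite κ] (r : ℕ) : ∀ n : ℕ, ∃ N : ℕ,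
    ∀ X : Finset ℕ, N ≤ X.card → ∀ f : List ℕ → κ, ∃ S ⊆ X, n ≤ S.card ∧
      ∃ c, ∀ l : List ℕ, l.length = r → l.Pairwise (· < ·) → (∀ x ∈ l, x ∈ S) → f l = c := by
  classical
  have := Fintype.ofFinite κ
  induction r with
  | zero =>
    intro n
    refine ⟨n, fun X hX f => ⟨X, subset_rfl, hX, f [], fun l hl _ _ => ?_⟩⟩
    rw [List.eq_nil_of_length_eq_zero hl]
  | succ r ih =>
    -- It suffices to make the colour depend on the first element only; the pigeonhole principle
    -- then selects first elements with a common colour.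
    have endhom : ∀ n : ℕ, ∃ N : ℕ, ∀ X : Finset ℕ, N ≤ X.card → ∀ f : List ℕ → κ,
        ∃ S ⊆ X, n ≤ S.card ∧ ∃ c : ℕ → κ, ∀ (a : ℕ) (l : List ℕ), l.length = r →
          (a :: l).Pairwise (· < ·) → (∀ x ∈ a :: l, x ∈ S) → f (a :: l) = c a := by
      intro n
      induction n with
      | zero =>
        refine ⟨0, fun X _ f => ⟨∅, by simp, by simp, fun a => f [], fun a l _ _ h => ?_⟩⟩
        simpa using h a
      | succ n ihn =>
        obtain ⟨N₁, hN₁⟩ := ihn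
        obtain ⟨N₂, hN₂⟩ := ih N₁
        refine ⟨N₂ + 1, fun X hX f => ?_⟩
        have hne : X.Nonempty := Finset.card_pos.1 (by omega)
        obtain ⟨Y, hY, hYc, c₀, hc₀⟩ := hN₂ (X.erase (X.min' hne))
          (by rw [Finset.card_erase_of_mem (X.min'_mem hne)]; omega)
          (fun l => f (X.min' hne :: l))
        obtain ⟨S, hS, hSc, c, hc⟩ := hN₁ Y hYc f
        have hlt : ∀ x ∈ S, X.min' hne < x := fun x hx => by
          have := Finset.mem_erase.1 (hY (hS hx))
          exact lt_of_le_of_ne (X.min'_le x this.2) this.1.symm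
        have hnot : X.min' hne ∉ S := fun h => (hlt _ h).false
        refine ⟨insert (X.min' hne) S, ?_, ?_, Function.update c (X.min' hne) c₀, ?_⟩
        · exact Finset.insert_subset (X.min'_mem hne)
            (hS.trans (hY.trans (Finset.erase_subset _ _)))
        · rw [Finset.card_insert_of_notMem hnot]; omega
        · intro a l hl hp hmem
          have hmem' : ∀ x ∈ l, x ∈ S := by
            intro x hx
            rcases Finset.mem_insert.1 (hmem x (List.mem_cons_of_mem _ hx)) with h | h
            · have h1 : a < x := List.rel_of_pairwise_cons hp hx
              rcases Finset.mem_insert.1 (hmem a List.mem_cons_self) with h2 | h2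
              · omega
              · have := hlt a h2
                omega
            · exact h
          rcases Finset.mem_insert.1 (hmem a List.mem_cons_self) with h2 | h2
          · subst h2
            rw [Function.update_self]
            exact hc₀ l hl (List.Pairwise.of_cons hp) fun x hx => hS (hmem' x hx)
          · rw [Function.update_of_ne (fun h : a = X.min' hne => hnot (h ▸ h2))]
            refine hc a l hl hp fun x hx => ?_
            rcases List.mem_cons.1 hx with rfl | hx
            · exact h2
            · exact hmem' x hx
    intro n
    obtain ⟨N, hN⟩ := endhom (Fintype.card κ * n)
    refine ⟨N, fun X hX f => ?_⟩
    obtain ⟨S, hS, hSc, c, hc⟩ := hN X hX f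
    rcases Nat.eq_zero_or_pos n with rfl | hn
    · refine ⟨∅, by simp, by simp, f [], fun l hl _ h => ?_⟩
      cases l with
      | nil => simp at hl
      | cons a l => simpa using h a
    have : Nonempty κ := ⟨f []⟩
    obtain ⟨y, -, hy⟩ := Finset.exists_le_card_fiber_of_mul_le_card_of_maps_to
      (s := S) (t := Finset.univ) (f := c) (n := n) (fun _ _ => Finset.mem_univ _)
      Finset.univ_nonempty (by simpa using hSc)
    refine ⟨S.filter (fun x => c x = y), (Finset.filter_subset _ _).trans hS, hy, y, ?_⟩
    intro l hl hp hmem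
    cases l with
    | nil => simp at hl
    | cons a l =>
      rw [hc a l (by simpa using hl) hp fun x hx => (Finset.mem_filter.1 (hmem x hx)).1]
      exact (Finset.mem_filter.1 (hmem a List.mem_cons_self)).2

/-! ### Shortest walks inside a vertex set. -/

/-- The edges of `G` with both ends in `T`, as a graph on all vertices of `G`. -/
def SimpleGraph.within {V : Type*} (G : SimpleGraph V) (T : Set V) : SimpleGraph V where
  Adj x y := G.Adj x y ∧ x ∈ T ∧ y ∈ T
  symm := ⟨fun _ _ h => ⟨h.1.symm, h.2.2, h.2.1⟩⟩
  loopless := ⟨fun _ h => h.1.ne rfl⟩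

theorem SimpleGraph.within_le {V : Type*} (G : SimpleGraph V) (T : Set V) : G.within T ≤ G :=
  fun _ _ h => h.1

theorem SimpleGraph.Walk.support_subset_of_within {V : Type*} {G : SimpleGraph V} {T : Set V}
    {a b : V} (w : (G.within T).Walk a b) (ha : a ∈ T) : ∀ x ∈ w.support, x ∈ T := by
  induction w with
  | nil => simpa using ha
  | cons h _ ih =>
    intro x hx
    rcases List.mem_cons.1 hx with rfl | hx
    · exact ha
    · exact ih h.2.2 x hx

theorem SimpleGraph.Reachable.mem_of_within {V : Type*} {G : SimpleGraph V} {T : Set V}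
    {a b : V} (h : (G.within T).Reachable a b) (ha : a ∈ T) : b ∈ T := by
  obtain ⟨w⟩ := h
  exact w.support_subset_of_within ha _ w.end_mem_support

/-- `p 0, …, p N` is an induced path of `G`. -/
structure IsInducedPath {V : Type*} (G : SimpleGraph V) (p : ℕ → V) (N : ℕ) : Prop where
  inj : ∀ i ≤ N, ∀ j ≤ N, p i = p j → i = j
  adj : ∀ i ≤ N, ∀ j ≤ N, G.Adj (p i) (p j) ↔ (i + 1 = j ∨ j + 1 = i)

theorem SimpleGraph.Walk.dist_getVert {V : Type*} {G : SimpleGraph V} {a b : V} (w : G.Walk a b)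
    (hw : w.length = G.dist a b) {i : ℕ} (hi : i ≤ w.length) : G.dist a (w.getVert i) = i := by
  have h1 := G.dist_le (w.take i)
  have h2 := G.dist_le (w.drop i)
  have h3 := (w.drop i).reachable.dist_triangle_right a
  rw [SimpleGraph.Walk.take_length] at h1
  rw [SimpleGraph.Walk.drop_length] at h2
  omega

/-- An edge of `G` between two vertices of the walk has both ends in `T`, so it changes the distance
from `a` within `T` by at most one and cannot be a chord of a shortest walk. -/
theorem IsInducedPath.of_dist {V : Type*} {G : SimpleGraph V} {T : Set V} {a b : V}
    (w : (G.within T).Walk a b) (ha : a ∈ T) (hw : w.length = (G.within T).dist a b) :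
    IsInducedPath G w.getVert w.length := by
  have hT : ∀ i, w.getVert i ∈ T := fun i =>
    w.support_subset_of_within ha _ (w.getVert_mem_support i)
  constructor
  · intro i hi j hj h
    rw [← w.dist_getVert hw hi, h, w.dist_getVert hw hj]
  · intro i hi j hj
    constructor
    · intro h
      have h' : (G.within T).Adj (w.getVert i) (w.getVert j) := ⟨h, hT i, hT j⟩
      have hne : i ≠ j := fun hij => h.ne (by rw [hij])
      have h1 := h'.reachable.dist_triangle_right a
      have h2 := h'.symm.reachable.dist_triangle_right a
      rw [SimpleGraph.dist_eq_one_iff_adj.2 h'] at h1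
      rw [SimpleGraph.dist_eq_one_iff_adj.2 h'.symm] at h2
      rw [w.dist_getVert hw hi, w.dist_getVert hw hj] at h1 h2
      omega
    · rintro (rfl | rfl)
      · exact (w.adj_getVert_succ (by omega)).1
      · exact (w.adj_getVert_succ (by omega)).1.symm

theorem IsInducedPath.mono {V : Type*} {G : SimpleGraph V} {p : ℕ → V} {M N : ℕ}
    (h : IsInducedPath G p M) (hNM : N ≤ M) : IsInducedPath G p N :=
  ⟨fun i hi j hj => h.inj i (hi.trans hNM) j (hj.trans hNM),
    fun i hi j hj => h.adj i (hi.trans hNM) j (hj.trans hNM)⟩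

theorem SimpleGraph.reachable_of_steps {V : Type*} {G : SimpleGraph V} (s : ℕ → V) (m n : ℕ)
    (hmn : m ≤ n) (h : ∀ i, m ≤ i → i < n → s i = s (i + 1) ∨ G.Adj (s i) (s (i + 1))) :
    G.Reachable (s m) (s n) := by
  induction n, hmn using Nat.le_induction with
  | base => rfl
  | succ n hn ih =>
    refine (ih fun i hi hi' => h i hi (by omega)).trans ?_
    rcases h n hn (by omega) with h | h
    · rw [h]
    · exact h.reachable

theorem Finset.exists_increasing (S : Finset ℕ) {n : ℕ} (h : n ≤ S.card) :
    ∃ α : ℕ → ℕ, (∀ i < n, α i ∈ S) ∧ ∀ i j, i < j → j < n → α i < α j := by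
  refine ⟨fun i => if h : i < S.card then S.orderEmbOfFin rfl ⟨i, h⟩ else 0, fun i hi => ?_,
    fun i j hij hj => ?_⟩
  · simp [dif_pos (hi.trans_le h)]
  · simp [dif_pos (hj.trans_le h), dif_pos ((hij.trans hj).trans_le h), hij]

/-! ### From a long path to a long induced path or a large biclique. -/

/-- A long path yields a long induced path or a large complete bipartite subgraph. -/
theorem exists_inducedPath_or_biclique (N t : ℕ) : ∃ M : ℕ, ∀ (V : Type u) (G : SimpleGraph V)
    (p : ℕ → V), (∀ i ≤ M, ∀ j ≤ M, p i = p j → i = j) → (∀ i < M, G.Adj (p i) (p (i + 1))) →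
    (∃ q, IsInducedPath G q N) ∨ ∃ u v : Fin t → V, Function.Injective u ∧ Function.Injective v ∧
      ∀ i j, G.Adj (u i) (v j) := by
  classical
  set n := 4 * t + N + 2 with hn
  obtain ⟨M, hM⟩ := exists_monochromatic_lists (κ := Option (Fin (N + 1) × Fin (N + 1))) 4 n
  refine ⟨M, fun V G p hinj hadj => ?_⟩
  by_contra! hcon
  obtain ⟨hcon, hbi⟩ := hcon
  -- `s a b` is a shortest walk from `p a` to `p b` within that segment of the path, constant after
  -- its end. It has at most `N` edges, since otherwise it would contain the desired induced path.
  have hs : ∀ a b, ∃ s : ℕ → V, a ≤ b → b ≤ M → s 0 = p a ∧ (∃ e ≤ N, s e = p b) ∧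
      (∀ r, ∃ i, a ≤ i ∧ i ≤ b ∧ s r = p i) ∧
      ∀ r, s r = s (r + 1) ∨ G.Adj (s r) (s (r + 1)) := by
    intro a b
    by_cases hab : a ≤ b ∧ b ≤ M
    swap
    · exact ⟨p, fun h1 h2 => absurd ⟨h1, h2⟩ hab⟩
    obtain ⟨hab, hb⟩ := hab
    set T : Set V := p '' Set.Icc a b
    have hr : (G.within T).Reachable (p a) (p b) :=
      SimpleGraph.reachable_of_steps p a b hab fun i hi hi' => .inr
        ⟨hadj i (by omega), ⟨i, ⟨hi, hi'.le⟩, rfl⟩, ⟨i + 1, ⟨by omega, hi'⟩, rfl⟩⟩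
    obtain ⟨w, hw⟩ := hr.exists_walk_length_eq_dist
    have haT : p a ∈ T := ⟨a, ⟨le_rfl, hab⟩, rfl⟩
    have hlen : w.length ≤ N := by
      by_contra! hlt
      exact hcon _ ((IsInducedPath.of_dist w haT hw).mono hlt.le)
    refine ⟨w.getVert, fun _ _ => ⟨w.getVert_zero, ⟨_, hlen, w.getVert_length⟩, fun r => ?_,
      fun r => ?_⟩⟩
    · obtain ⟨i, hi, h⟩ := w.support_subset_of_within haT _ (w.getVert_mem_support r)
      exact ⟨i, hi.1, hi.2, h.symm⟩
    · by_cases hr : r < w.length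
      · exact .inr (w.adj_getVert_succ hr).1
      · left
        rw [w.getVert_of_length_le (by omega), w.getVert_of_length_le (by omega)]
  choose s hs using hs
  let E : ℕ → ℕ → ℕ → ℕ → Fin (N + 1) × Fin (N + 1) → Prop := fun a b c d rq =>
    G.Adj (s a b rq.1) (s c d rq.2)
  -- A quadruple is coloured by positions `(r, q)` at which the shortcuts of its first and second
  -- pair are adjacent, or by `none` if no edge joins the two shortcuts.
  let f : List ℕ → Option (Fin (N + 1) × Fin (N + 1)) := fun l => match l with
    | [a, b, c, d] => if h : ∃ rq, E a b c d rq then some h.choose else none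
    | _ => none
  obtain ⟨S, hSX, hSc, c, hc⟩ := hM (Finset.range (M + 1)) (by simp) f
  obtain ⟨α, hαS, hα⟩ := S.exists_increasing hSc
  have hαM : ∀ i < n, α i ≤ M := fun i hi => by
    have := hSX (hαS i hi)
    simp at this
    omega
  have hαle : ∀ i j, i ≤ j → j < n → α i ≤ α j := fun i j hij hj => by
    rcases hij.eq_or_lt with rfl | h
    · rfl
    · exact (hα i j h hj).le
  have hf : ∀ i j k l, i < j → j < k → k < l → l < n → f [α i, α j, α k, α l] = c := by
    intro i j k l hij hjk hkl hl
    refine hc [α i, α j, α k, α l] rfl ?_ ?_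
    · have h1 := hα i j hij (by omega)
      have h2 := hα j k hjk (by omega)
      have h3 := hα k l hkl (by omega)
      simp
      omega
    · simp only [List.mem_cons, List.not_mem_nil, or_false]
      rintro x (rfl | rfl | rfl | rfl) <;> exact hαS _ (by omega)
  have hs' : ∀ i, i + 1 < n → _ := fun i hi =>
    hs (α i) (α (i + 1)) (hαle _ _ (by omega) hi) (hαM _ hi)
  cases c with
  | some rq =>
    have hE : ∀ i j k l, i < j → j < k → k < l → l < n → E (α i) (α j) (α k) (α l) rq := by
      intro i j k l hij hjk hkl hl
      have := hf i j k l hij hjk hkl hl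
      simp only [f] at this
      split_ifs at this with h
      obtain rfl := Option.some.inj this
      exact h.choose_spec
    have hinj' : ∀ (r i j : ℕ), i < j → 2 * j + 1 < n →
        s (α (2 * i)) (α (2 * i + 1)) r ≠ s (α (2 * j)) (α (2 * j + 1)) r := by
      intro r i j hij hj h
      obtain ⟨x, hx1, hx2, hx⟩ := (hs' (2 * i) (by omega)).2.2.1 r
      obtain ⟨y, hy1, hy2, hy⟩ := (hs' (2 * j) (by omega)).2.2.1 r
      have h1 := hα (2 * i + 1) (2 * j) (by omega) (by omega)
      have h2 := hαM (2 * j + 1) (by omega)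
      have := hinj x (by omega) y (by omega) (by rw [← hx, ← hy, h])
      omega
    have hinj'' : ∀ (r i j : ℕ), 2 * i + 1 < n → 2 * j + 1 < n →
        s (α (2 * i)) (α (2 * i + 1)) r = s (α (2 * j)) (α (2 * j + 1)) r → i = j := by
      intro r i j hi hj h
      rcases lt_trichotomy i j with h' | h' | h'
      · exact (hinj' r i j h' hj h).elim
      · exact h'
      · exact (hinj' r j i h' hi h.symm).elim
    -- The `2 * t` disjoint segments between consecutive pairs of the first `4 * t` indices are
    -- used: the first `t` supply one side of the biclique, the others the second.
    obtain ⟨i, j, hij⟩ := hbi (fun i => s (α (2 * i)) (α (2 * i + 1)) rq.1)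
      (fun j => s (α (2 * (t + j))) (α (2 * (t + j) + 1)) rq.2)
      (fun i j h => Fin.ext (hinj'' _ _ _ (by omega) (by omega) h))
      (fun i j h => Fin.ext (by have := hinj'' _ _ _ (by omega) (by omega) h; omega))
    exact hij (hE _ _ _ _ (by omega) (by omega) (by omega) (by omega))
  | none =>
    have hE : ∀ i j k l, i < j → j < k → k < l → l < n → ∀ rq, ¬ E (α i) (α j) (α k) (α l) rq := by
      intro i j k l hij hjk hkl hl rq hrq
      have := hf i j k l hij hjk hkl hl
      simp only [f] at this
      rw [dif_pos ⟨rq, hrq⟩] at this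
      cases this
    let W : ℕ → Set V := fun i => {x | ∃ r ≤ N, x = s (α i) (α (i + 1)) r}
    let U : Set V := {x | ∃ i, i + 1 < n ∧ x ∈ W i}
    have hreach : (G.within U).Reachable (p (α 0)) (p (α (n - 1))) := by
      have : ∀ j, j < n → (G.within U).Reachable (p (α 0)) (p (α j)) := by
        intro j
        induction j with
        | zero => exact fun _ => .rfl
        | succ j ih =>
          intro hj
          refine (ih (by omega)).trans ?_
          obtain ⟨h0, ⟨e, he, hse⟩, -, hst⟩ := hs' j hj
          rw [← h0, ← hse]
          refine SimpleGraph.reachable_of_steps _ 0 e (by omega) fun r _ hr => ?_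
          exact (hst r).imp_right fun h =>
            ⟨h, ⟨j, hj, r, by omega, rfl⟩, ⟨j, hj, r + 1, by omega, rfl⟩⟩
      exact this _ (by omega)
    obtain ⟨w, hw⟩ := hreach.exists_walk_length_eq_dist
    have h0W : p (α 0) ∈ W 0 := ⟨0, by omega, (hs' 0 (by omega)).1.symm⟩
    -- No edge joins shortcuts whose indices differ by two or more, so each step of a walk raises
    -- the level by at most one. Reaching the last vertex thus takes at least `n - 2 ≥ N` steps.
    have hlev : ∀ (x y : V) (w : (G.within U).Walk x y) (i : ℕ), i + 1 < n → x ∈ W i →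
        ∃ j, j + 1 < n ∧ j ≤ i + w.length ∧ y ∈ W j := by
      intro x y w
      induction w with
      | nil => exact fun i hi hx => ⟨i, hi, by simp, hx⟩
      | cons h w ih =>
        intro i hi hx
        obtain ⟨i', hi', hx'⟩ := h.2.2
        obtain ⟨j, hj, hjl, hy⟩ := ih i' hi' hx'
        refine ⟨j, hj, ?_, hy⟩
        rw [SimpleGraph.Walk.length_cons]
        by_contra! hlt
        obtain ⟨r, hr, hxr⟩ := hx
        obtain ⟨q, hq, hxq⟩ := hx'
        refine hE i (i + 1) i' (i' + 1) (by omega) (by omega) (by omega) hi'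
          (⟨r, by omega⟩, ⟨q, by omega⟩) ?_
        simp only [E]
        rw [← hxr, ← hxq]
        exact h.1
    obtain ⟨j, hj, hjl, r, hr, hpr⟩ := hlev _ _ w 0 (by omega) h0W
    obtain ⟨x, hx1, hx2, hx⟩ := (hs' j hj).2.2.1 r
    have h1 := hαM (j + 1) hj
    have h2 := hinj _ (hαM (n - 1) (by omega)) x (by omega) (by rw [hpr, hx])
    have h3 : n ≤ j + 2 := by
      by_contra! hlt
      have := hα (j + 1) (n - 1) (by omega) (by omega)
      omega
    exact hcon _ ((IsInducedPath.of_dist w ⟨0, by omega, h0W⟩ hw).mono (by omega))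

/-! ### Legs and the assembly of copies of H. -/

/-- `Leg G S v n`: there is a path of `G` with `n` edges that starts in `v` and whose other
vertices lie in `S`. (The vertex `v` may lie in `S`, in which case it could be reused.) -/
inductive Leg {V : Type*} (G : SimpleGraph V) : Set V → V → ℕ → Prop
  | nil (S : Set V) (v : V) : Leg G S v 0
  | cons {S : Set V} {v w : V} {n : ℕ} (hw : w ∈ S) (h : G.Adj v w) (l : Leg G (S \ {w}) w n) :
      Leg G S v (n + 1)

namespace Leg

variable {V : Type*} {G : SimpleGraph V} {S T : Set V} {u v w : V} {n : ℕ}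

theorem mono (h : Leg G S v n) : ∀ {T : Set V}, S ⊆ T → Leg G T v n := by
  induction h with
  | nil => exact fun _ => .nil _ _
  | cons hw h _ ih => exact fun hST => .cons (hST hw) h (ih (Set.sdiff_subset_sdiff_left hST))

theorem of_le (h : Leg G S v n) : ∀ {m : ℕ}, m ≤ n → Leg G S v m := by
  induction h with
  | nil =>
    intro m hm
    obtain rfl : m = 0 := by omega
    exact .nil _ _
  | cons hw h _ ih =>
    intro m hm
    cases m with
    | zero => exact .nil _ _
    | succ m => exact .cons hw h (ih (by omega))

theorem insert (h : G.Adj v w) (l : Leg G S w n) (hw : w ∉ S) :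
    Leg G (insert w S) v (n + 1) :=
  .cons (Set.mem_insert _ _) h (l.mono fun _ hx => ⟨.inr hx, fun h => hw (h ▸ hx)⟩)

theorem prepend (p : G.Walk u v) (hp : p.IsPath) (l : Leg G S v n) :
    ∀ {T : Set V}, (∀ x ∈ p.support, x ≠ u → x ∈ T) → Disjoint T S →
      Leg G (T ∪ S) u (n + p.length) := by
  induction p with
  | nil => exact fun _ _ => l.mono Set.subset_union_right
  | @cons a b c h p ih =>
    intro T hT hd
    rw [SimpleGraph.Walk.cons_isPath_iff] at hp
    have hb : b ∈ T := hT b (by simp) h.ne'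
    have := ih hp.1 l (T := T \ {b}) (fun x hx hxb => ⟨hT x (by simp [hx]) (by
      rintro rfl; exact hp.2 hx), hxb⟩) (hd.mono_left Set.sdiff_subset)
    refine .cons (.inl hb) h (this.mono ?_)
    rintro x (hx | hx)
    · exact ⟨.inl hx.1, hx.2⟩
    · refine ⟨.inr hx, ?_⟩
      rintro rfl
      exact Set.disjoint_left.1 hd hb hx

theorem exists_fun (h : Leg G S v n) : ∃ f : ℕ → V, f 0 = v ∧ (∀ i < n, G.Adj (f i) (f (i + 1))) ∧
    (∀ i < n, f (i + 1) ∈ S) ∧ ∀ i < n, ∀ j < n, f (i + 1) = f (j + 1) → i = j := by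
  induction h with
  | nil S v => exact ⟨fun _ => v, rfl, by simp, by simp, by simp⟩
  | @cons S v w n hw h l ih =>
    obtain ⟨f, h0, h1, h2, h3⟩ := ih
    refine ⟨fun i => Nat.casesOn i v f, rfl, ?_, ?_, ?_⟩
    · rintro (_ | i) hi
      · simpa [h0] using h
      · exact h1 i (by omega)
    · rintro (_ | i) hi
      · simpa [h0] using hw
      · exact (h2 i (by omega)).1
    · rintro (_ | i) hi (_ | j) hj hij
      · rfl
      · exact absurd (hij.symm.trans h0) (h2 j (by omega)).2
      · exact absurd (hij.trans h0) (h2 i (by omega)).2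
      · rw [h3 i (by omega) j (by omega) hij]

end Leg

/-- Reduces finding H to bookkeeping on sets: legs confined to pairwise disjoint sets that avoid the
spine cannot collide. -/
theorem subdividedH_isContained {V : Type*} {G : SimpleGraph V} {m a b c d : ℕ} {σ : ℕ → V}
    {A B C D : Set V} (hσ : ∀ i < m, G.Adj (σ i) (σ (i + 1)))
    (hinj : ∀ i ≤ m, ∀ j ≤ m, σ i = σ j → i = j)
    (hA : Leg G A (σ 0) a) (hB : Leg G B (σ 0) b) (hC : Leg G C (σ m) c) (hD : Leg G D (σ m) d)
    (hσA : ∀ i ≤ m, σ i ∉ A) (hσB : ∀ i ≤ m, σ i ∉ B) (hσC : ∀ i ≤ m, σ i ∉ C)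
    (hσD : ∀ i ≤ m, σ i ∉ D) (hAB : Disjoint A B) (hAC : Disjoint A C) (hAD : Disjoint A D)
    (hBC : Disjoint B C) (hBD : Disjoint B D) (hCD : Disjoint C D) :
    (subdividedH m a b c d).IsContained G := by
  obtain ⟨fA, hA0, hA1, hA2, hA3⟩ := hA.exists_fun
  obtain ⟨fB, hB0, hB1, hB2, hB3⟩ := hB.exists_fun
  obtain ⟨fC, hC0, hC1, hC2, hC3⟩ := hC.exists_fun
  obtain ⟨fD, hD0, hD1, hD2, hD3⟩ := hD.exists_fun
  rw [Set.disjoint_left] at *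
  let φ : HVertex m a b c d → V
    | .spine x => σ x
    | .legA x => fA (x + 1)
    | .legB x => fB (x + 1)
    | .legC x => fC (x + 1)
    | .legD x => fD (x + 1)
  refine ⟨⟨⟨φ, ?_⟩, ?_⟩⟩
  · intro x y hxy
    rw [subdividedH, SimpleGraph.fromRel_adj] at hxy
    obtain ⟨-, hxy | hxy⟩ := hxy
    · cases x <;> cases y <;> simp only at hxy
      · rename_i x y; simp only [φ, ← hxy]; exact hσ _ (by omega)
      · simp only [φ, hxy.1, hxy.2, ← hA0]; exact hA1 _ (by omega)
      · simp only [φ, hxy.1, hxy.2, ← hB0]; exact hB1 _ (by omega)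
      · simp only [φ, hxy.1, hxy.2, ← hC0]; exact hC1 _ (by omega)
      · simp only [φ, hxy.1, hxy.2, ← hD0]; exact hD1 _ (by omega)
      · simp only [φ, ← hxy]; exact hA1 _ (by omega)
      · simp only [φ, ← hxy]; exact hB1 _ (by omega)
      · simp only [φ, ← hxy]; exact hC1 _ (by omega)
      · simp only [φ, ← hxy]; exact hD1 _ (by omega)
    · refine SimpleGraph.Adj.symm ?_
      cases x <;> cases y <;> simp only at hxy
      · rename_i x y; simp only [φ, ← hxy]; exact hσ _ (by omega)
      · simp only [φ, hxy.1, hxy.2, ← hA0]; exact hA1 _ (by omega)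
      · simp only [φ, ← hxy]; exact hA1 _ (by omega)
      · simp only [φ, hxy.1, hxy.2, ← hB0]; exact hB1 _ (by omega)
      · simp only [φ, ← hxy]; exact hB1 _ (by omega)
      · simp only [φ, hxy.1, hxy.2, ← hC0]; exact hC1 _ (by omega)
      · simp only [φ, ← hxy]; exact hC1 _ (by omega)
      · simp only [φ, hxy.1, hxy.2, ← hD0]; exact hD1 _ (by omega)
      · simp only [φ, ← hxy]; exact hD1 _ (by omega)
  · have hne : ∀ {x y : V} {S T : Set V}, x ∈ S → y ∈ T → (∀ ⦃z⦄, z ∈ S → z ∉ T) → x ≠ y :=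
      fun hx hy h e => h hx (e ▸ hy)
    rintro (x | x | x | x | x) (y | y | y | y | y) hxy <;> simp only [φ, RelHom.coeFn_mk] at hxy
    · exact congrArg _ (Fin.ext (hinj _ (by omega) _ (by omega) hxy))
    · exact (hσA x (by omega) (hxy ▸ hA2 y y.2)).elim
    · exact (hσB x (by omega) (hxy ▸ hB2 y y.2)).elim
    · exact (hσC x (by omega) (hxy ▸ hC2 y y.2)).elim
    · exact (hσD x (by omega) (hxy ▸ hD2 y y.2)).elim
    · exact (hσA y (by omega) (hxy ▸ hA2 x x.2)).elim
    · exact congrArg _ (Fin.ext (hA3 _ x.2 _ y.2 hxy))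
    · exact (hne (hA2 x x.2) (hB2 y y.2) hAB hxy).elim
    · exact (hne (hA2 x x.2) (hC2 y y.2) hAC hxy).elim
    · exact (hne (hA2 x x.2) (hD2 y y.2) hAD hxy).elim
    · exact (hσB y (by omega) (hxy ▸ hB2 x x.2)).elim
    · exact (hne (hA2 y y.2) (hB2 x x.2) hAB hxy.symm).elim
    · exact congrArg _ (Fin.ext (hB3 _ x.2 _ y.2 hxy))
    · exact (hne (hB2 x x.2) (hC2 y y.2) hBC hxy).elim
    · exact (hne (hB2 x x.2) (hD2 y y.2) hBD hxy).elim
    · exact (hσC y (by omega) (hxy ▸ hC2 x x.2)).elim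
    · exact (hne (hA2 y y.2) (hC2 x x.2) hAC hxy.symm).elim
    · exact (hne (hB2 y y.2) (hC2 x x.2) hBC hxy.symm).elim
    · exact congrArg _ (Fin.ext (hC3 _ x.2 _ y.2 hxy))
    · exact (hne (hC2 x x.2) (hD2 y y.2) hCD hxy).elim
    · exact (hσD y (by omega) (hxy ▸ hD2 x x.2)).elim
    · exact (hne (hA2 y y.2) (hD2 x x.2) hAD hxy.symm).elim
    · exact (hne (hB2 y y.2) (hD2 x x.2) hBD hxy.symm).elim
    · exact (hne (hC2 y y.2) (hD2 x x.2) hCD hxy.symm).elim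
    · exact congrArg _ (Fin.ext (hD3 _ x.2 _ y.2 hxy))

/-- A subdivided "H"-graph is bipartite, so a large complete bipartite graph contains it. -/
theorem subdividedH_isContained_of_biclique {V : Type*} {G : SimpleGraph V} {m a b c d : ℕ}
    {u v : Fin (m + 1 + a + b + c + d) → V} (hu : Function.Injective u)
    (hv : Function.Injective v) (huv : ∀ i j, G.Adj (u i) (v j)) :
    (subdividedH m a b c d).IsContained G := by
  -- All vertices of H receive distinct indices, so neither colour class has to be counted.
  let idx : HVertex m a b c d → Fin (m + 1 + a + b + c + d)
    | .spine x => ⟨x, by omega⟩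
    | .legA x => ⟨m + 1 + x, by omega⟩
    | .legB x => ⟨m + 1 + a + x, by omega⟩
    | .legC x => ⟨m + 1 + a + b + x, by omega⟩
    | .legD x => ⟨m + 1 + a + b + c + x, by omega⟩
  have hidx : Function.Injective idx := by
    rintro (x | x | x | x | x) (y | y | y | y | y) hxy <;>
      simp only [idx, Fin.mk.injEq] at hxy <;> first | omega | skip
    all_goals exact congrArg _ (Fin.ext (by omega))
  -- The distance from the first spine vertex; its parity is a proper 2-colouring.
  let col : HVertex m a b c d → ℕ
    | .spine x => x
    | .legA x => x + 1
    | .legB x => x + 1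
    | .legC x => m + x + 1
    | .legD x => m + x + 1
  have hcol : ∀ x y, (subdividedH m a b c d).Adj x y → (col x % 2 = 0 ↔ ¬ col y % 2 = 0) := by
    intro x y hxy
    rw [subdividedH, SimpleGraph.fromRel_adj] at hxy
    obtain ⟨-, hxy | hxy⟩ := hxy <;> cases x <;> cases y <;> simp only at hxy <;>
      simp only [col] <;> omega
  refine ⟨⟨⟨fun x => if col x % 2 = 0 then u (idx x) else v (idx x), ?_⟩, ?_⟩⟩
  · intro x y hxy
    have := hcol x y hxy
    by_cases hx : col x % 2 = 0
    · rw [if_pos hx, if_neg (this.1 hx)]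
      exact huv _ _
    · rw [if_neg hx, if_pos (by tauto)]
      exact (huv _ _).symm
  · intro x y hxy
    have hne : ∀ i j, u i ≠ v j := fun i j => (huv i j).ne
    simp only [RelHom.coeFn_mk] at hxy
    split_ifs at hxy with h1 h2 h2
    · exact hidx (hu hxy)
    · exact (hne _ _ hxy).elim
    · exact (hne _ _ hxy.symm).elim
    · exact hidx (hv hxy)

/-! ### Components off an induced path and how they attach. -/

/-- The vertices off the path `p 0, …, p N`. -/
def outer {V : Type*} (p : ℕ → V) (N : ℕ) : Set V := {x | ∀ i ≤ N, x ≠ p i}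

/-- The component of the vertex `x` in `G` minus the path `p 0, …, p N` has a neighbour of `p i`. -/
def Attaches {V : Type*} (G : SimpleGraph V) (p : ℕ → V) (N : ℕ) (x : V) (i : ℕ) : Prop :=
  x ∈ outer p N ∧ i ≤ N ∧ ∃ y, (G.within (outer p N)).Reachable x y ∧ G.Adj (p i) y

theorem Leg.of_walk_within {V : Type*} {G : SimpleGraph V} {O S T : Set V} {u v : V} {n : ℕ}
    (w : (G.within O).Walk u v) (hw : w.IsPath) (l : Leg G S v n)
    (hT : ∀ x ∈ w.support, x ≠ u → x ∈ T) (hd : Disjoint T S) :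
    Leg G (T ∪ S) u (n + w.length) := by
  have := Leg.prepend (w.mapLe (G.within_le O)) (hw.mapLe _) l (T := T) (by simpa using hT) hd
  simpa using this

section

variable {V : Type*} {G : SimpleGraph V} {p : ℕ → V} {N k m : ℕ}

theorem Attaches.of_reachable {x y : V} {i : ℕ} (h : Attaches G p N x i)
    (hxy : (G.within (outer p N)).Reachable x y) : Attaches G p N y i :=
  ⟨hxy.mem_of_within h.1, h.2.1, h.2.2.imp fun _ hz => ⟨hxy.symm.trans hz.1, hz.2⟩⟩

theorem Attaches.of_adj {y : V} {i : ℕ} (hy : y ∈ outer p N) (hi : i ≤ N) (h : G.Adj (p i) y) :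
    Attaches G p N y i :=
  ⟨hy, hi, y, .rfl, h⟩

theorem notMem_outer {i : ℕ} (hi : i ≤ N) : p i ∉ outer p N := fun h => h i hi rfl

theorem notMem_image_of_outer {y : V} (hy : y ∈ outer p N) {I : Set ℕ} (hI : ∀ i ∈ I, i ≤ N) :
    y ∉ p '' I := by
  rintro ⟨i, hi, rfl⟩
  exact notMem_outer (hI i hi) hy

namespace IsInducedPath

variable (h : IsInducedPath G p N)
include h

theorem notMem_image {i : ℕ} {I : Set ℕ} (hi : i ≤ N) (hI : ∀ j ∈ I, j ≤ N) (hiI : i ∉ I) :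
    p i ∉ p '' I := by
  rintro ⟨j, hj, hji⟩
  exact hiI (h.inj j (hI j hj) i hi hji ▸ hj)

theorem disjoint_image {I J : Set ℕ} (hI : ∀ i ∈ I, i ≤ N) (hJ : ∀ i ∈ J, i ≤ N)
    (hIJ : ∀ i ∈ I, i ∉ J) : Disjoint (p '' I) (p '' J) := by
  rw [Set.disjoint_left]
  rintro _ ⟨i, hi, rfl⟩
  exact h.notMem_image (hI i hi) hJ (hIJ i hi)

theorem leg_up (n : ℕ) : ∀ j, j + n ≤ N → Leg G (p '' Set.Ico (j + 1) (j + 1 + n)) (p j) n := by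
  induction n with
  | zero => exact fun _ _ => .nil _ _
  | succ n ih =>
    intro j hj
    refine .cons (w := p (j + 1)) ⟨j + 1, by simp, rfl⟩
      ((h.adj _ (by omega) _ (by omega)).2 (.inl rfl)) ((ih (j + 1) (by omega)).mono ?_)
    rintro _ ⟨i, hi, rfl⟩
    simp only [Set.mem_Ico] at hi
    refine ⟨⟨i, by simp only [Set.mem_Ico]; omega, rfl⟩, fun hij => ?_⟩
    have := h.inj i (by omega) (j + 1) (by omega) hij
    omega

theorem leg_down (n : ℕ) : ∀ j, n ≤ j → j ≤ N → Leg G (p '' Set.Ico (j - n) j) (p j) n := by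
  induction n with
  | zero => exact fun _ _ _ => .nil _ _
  | succ n ih =>
    intro j hj hjN
    refine .cons (w := p (j - 1)) ⟨j - 1, by simp only [Set.mem_Ico]; omega, rfl⟩
      ((h.adj _ (by omega) _ (by omega)).2 (by omega))
      ((ih (j - 1) (by omega) (by omega)).mono ?_)
    rintro _ ⟨i, hi, rfl⟩
    simp only [Set.mem_Ico] at hi
    refine ⟨⟨i, by simp only [Set.mem_Ico]; omega, rfl⟩, fun hij => ?_⟩
    have := h.inj i (by omega) (j - 1) (by omega) hij
    omega

theorem leg_of_adj_up {y : V} {i n : ℕ} (hn : 1 ≤ n) (hi : i + n ≤ N + 1) (hy : G.Adj (p i) y) :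
    Leg G (p '' Set.Ico i (i + n)) y n := by
  obtain ⟨n, rfl⟩ : ∃ n', n = n' + 1 := ⟨n - 1, by omega⟩
  refine ((h.leg_up n i (by omega)).insert hy.symm (h.notMem_image (by omega) ?_ ?_)).mono ?_
  · simp only [Set.mem_Ico]; omega
  · simp
  · rintro _ (rfl | ⟨j, hj, rfl⟩)
    · exact ⟨i, by simp, rfl⟩
    · exact ⟨j, by simp only [Set.mem_Ico] at *; omega, rfl⟩

theorem reverse : IsInducedPath G (fun i => p (N - i)) N := by
  constructor
  · intro i hi j hj hij
    have := h.inj _ (by omega) _ (by omega) hij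
    omega
  · intro i hi j hj
    rw [h.adj _ (by omega) _ (by omega)]
    omega

/-- A vertex of an induced path has at most two neighbours on it, so a third neighbour lies off the
path. -/
theorem exists_outer_adj (hdeg : ∀ v a b, ∃ y, G.Adj v y ∧ y ≠ a ∧ y ≠ b) {i : ℕ} (hi : i ≤ N) :
    ∃ y ∈ outer p N, G.Adj (p i) y := by
  by_cases h0 : i = 0
  · subst h0
    obtain ⟨y, hy, h1, -⟩ := hdeg (p 0) (p 1) (p 1)
    refine ⟨y, fun j hj hyj => ?_, hy⟩
    subst hyj
    obtain rfl | hj := (h.adj 0 hi j hj).1 hy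
    · exact h1 rfl
    · omega
  · obtain ⟨y, hy, h1, h2⟩ := hdeg (p i) (p (i - 1)) (p (i + 1))
    refine ⟨y, fun j hj hyj => ?_, hy⟩
    subst hyj
    obtain rfl | hj := (h.adj i hi j hj).1 hy
    · exact h2 rfl
    · exact h1 (by rw [← hj]; rfl)

/-- The spine is the path from `p (j + m)` down to `p j`. The upper end carries `z` and the path
continuing upwards, the lower end the two given legs. -/
theorem isContained_of_legs {j : ℕ} (hj : j + m + k ≤ N) {S T : Set V} (hS : Leg G S (p j) k)
    (hT : Leg G T (p j) k) (hST : Disjoint S T) (hSp : ∀ i, j ≤ i → i ≤ N → p i ∉ S)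
    (hTp : ∀ i, j ≤ i → i ≤ N → p i ∉ T) {z : V} (hz : z ∈ outer p N) (hzj : G.Adj (p (j + m)) z)
    (hzS : z ∉ S) (hzT : z ∉ T) : (subdividedH m 1 k k k).IsContained G := by
  have hI : ∀ i ∈ Set.Ico (j + m + 1) (j + m + 1 + k), i ≤ N := by
    simp only [Set.mem_Ico]; omega
  have hd : ∀ {S : Set V}, (∀ i, j ≤ i → i ≤ N → p i ∉ S) →
      Disjoint (p '' Set.Ico (j + m + 1) (j + m + 1 + k)) S := by
    intro S hS
    rw [Set.disjoint_left]
    rintro _ ⟨i, hi, rfl⟩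
    exact hS i (by simp only [Set.mem_Ico] at hi; omega) (hI i hi)
  have hne : ∀ i ≤ N, p i ≠ z := fun i hi hiz => notMem_outer hi (hiz ▸ hz)
  refine subdividedH_isContained (σ := fun i => p (j + m - i)) (A := {z})
    (B := p '' Set.Ico (j + m + 1) (j + m + 1 + k)) (C := S) (D := T) ?_ ?_ ?_
    (h.leg_up k (j + m) hj) (by simpa using hS) (by simpa using hT) ?_ ?_ ?_ ?_ ?_ ?_ ?_ (hd hSp)
    (hd hTp) hST
  · exact fun i hi => (h.adj _ (by omega) _ (by omega)).2 (by omega)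
  · intro i hi i' hi' hii
    have := h.inj _ (by omega) _ (by omega) hii
    omega
  · exact .cons rfl hzj (.nil _ _)
  · exact fun i _ => hne _ (by omega)
  · exact fun i hi => h.notMem_image (by omega) hI (by simp only [Set.mem_Ico]; omega)
  · exact fun i hi => hSp _ (by omega) (by omega)
  · exact fun i hi => hTp _ (by omega) (by omega)
  · exact Set.disjoint_singleton_left.2 (notMem_image_of_outer hz hI)
  · exact Set.disjoint_singleton_left.2 hzS
  · exact Set.disjoint_singleton_left.2 hzT

/-- The opposite orientation: the short leg `z` sits at the lower end `p j`, next to the path going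
down, and the given leg at the upper end. -/
theorem isContained_of_leg_of_le {j : ℕ} (hkj : k ≤ j) (hj : j + m + k ≤ N) {S : Set V}
    (hS : Leg G S (p (j + m)) k) (hSp : ∀ i, j - k ≤ i → i ≤ N → p i ∉ S) {z : V}
    (hz : z ∈ outer p N) (hzj : G.Adj (p j) z) (hzS : z ∉ S) :
    (subdividedH m 1 k k k).IsContained G := by
  have hI : ∀ i ∈ Set.Ico (j + m + 1) (j + m + 1 + k), i ≤ N := by
    simp only [Set.mem_Ico]; omega
  have hI' : ∀ i ∈ Set.Ico (j - k) j, i ≤ N := by simp only [Set.mem_Ico]; omega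
  have hne : ∀ i ≤ N, p i ≠ z := fun i hi hiz => notMem_outer hi (hiz ▸ hz)
  refine subdividedH_isContained (σ := fun i => p (j + i)) (A := {z}) (B := p '' Set.Ico (j - k) j)
    (C := p '' Set.Ico (j + m + 1) (j + m + 1 + k)) (D := S) ?_ ?_ ?_
    (h.leg_down k j hkj (by omega)) (h.leg_up k (j + m) hj) hS ?_ ?_ ?_ ?_ ?_ ?_ ?_ ?_ ?_ ?_
  · exact fun i hi => (h.adj _ (by omega) _ (by omega)).2 (by omega)
  · intro i hi i' hi' hii
    have := h.inj _ (by omega) _ (by omega) hii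
    omega
  · exact .cons rfl hzj (.nil _ _)
  · exact fun i _ => hne _ (by omega)
  · exact fun i hi => h.notMem_image (by omega) hI' (by simp only [Set.mem_Ico]; omega)
  · exact fun i hi => h.notMem_image (by omega) hI (by simp only [Set.mem_Ico]; omega)
  · exact fun i hi => hSp _ (by omega) (by omega)
  · exact Set.disjoint_singleton_left.2 (notMem_image_of_outer hz hI')
  · exact Set.disjoint_singleton_left.2 (notMem_image_of_outer hz hI)
  · exact Set.disjoint_singleton_left.2 hzS
  · exact h.disjoint_image hI' hI (by simp only [Set.mem_Ico]; omega)
  · rw [Set.disjoint_left]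
    rintro _ ⟨i, hi, rfl⟩
    exact hSp i hi.1 (hI' i hi)
  · rw [Set.disjoint_left]
    rintro _ ⟨i, hi, rfl⟩
    exact hSp i (by simp only [Set.mem_Ico] at hi; omega) (hI i hi)

/-- A leg that leaves the path at `p j`, runs through a component of the rest by a shortest route
and returns to the path at `p i`. -/
theorem leg_of_handle {i j : ℕ} {y y₀ : V} (hk : 1 ≤ k) (hi : i + k ≤ N + 1)
    (hy : y ∈ outer p N) (hyj : G.Adj (p j) y)
    (hyy : (G.within (outer p N)).Reachable y y₀) (hy₀ : G.Adj (p i) y₀) :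
    Leg G ({z | z ∈ outer p N ∧ (G.within (outer p N)).Reachable y z ∧
      (z = y ∨ (G.within (outer p N)).dist y₀ z < (G.within (outer p N)).dist y₀ y)} ∪
      p '' Set.Ico i (i + k)) (p j) k := by
  obtain ⟨w, hw⟩ := hyy.symm.exists_walk_length_eq_dist
  have hwp := w.isPath_of_length_eq_dist hw
  have hI : ∀ j ∈ Set.Ico i (i + k), j ≤ N := by simp only [Set.mem_Ico]; omega
  have hsupp : ∀ x ∈ w.reverse.support, x ≠ y →
      x ∈ {z | z ∈ outer p N ∧ (G.within (outer p N)).Reachable y z ∧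
      ((G.within (outer p N)).dist y₀ z < (G.within (outer p N)).dist y₀ y)} := by
    intro x hx hxy
    rw [SimpleGraph.Walk.support_reverse, List.mem_reverse,
      SimpleGraph.Walk.mem_support_iff_exists_getVert] at hx
    obtain ⟨n, rfl, hn⟩ := hx
    have hr : (G.within (outer p N)).Reachable y (w.getVert n) :=
      hyy.trans (w.take n).reachable
    refine ⟨hr.mem_of_within hy, hr, ?_⟩
    rw [w.dist_getVert hw hn, ← hw]
    refine lt_of_le_of_ne hn fun h => hxy ?_
    rw [h, w.getVert_length]
  have hd : Disjoint {z | z ∈ outer p N ∧ (G.within (outer p N)).Reachable y z ∧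
      ((G.within (outer p N)).dist y₀ z < (G.within (outer p N)).dist y₀ y)}
      (p '' Set.Ico i (i + k)) := by
    rw [Set.disjoint_left]
    exact fun z hz => notMem_image_of_outer hz.1 hI
  have l := Leg.of_walk_within w.reverse hwp.reverse (h.leg_of_adj_up hk hi hy₀) hsupp hd
  refine ((l.insert hyj ?_).of_le (m := k) (by omega)).mono ?_
  · rintro (hz | hz)
    · exact hz.2.2.false
    · exact notMem_image_of_outer hy hI hz
  · rintro z (rfl | hz | hz)
    · exact .inl ⟨hy, .rfl, .inl rfl⟩
    · exact .inl ⟨hz.1, hz.2.1, .inr hz.2.2⟩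
    · exact .inr hz

/-- If a component attaches far to the left of `p j`, then its neighbours of `p j` and the outer
neighbours of `p (j + m)` are one and the same vertex. -/
theorem eq_of_handle (hH : ¬ (subdividedH m 1 k k k).IsContained G) (hk : 1 ≤ k) {i j : ℕ}
    (hij : i + 2 * k ≤ j) (hj : j + m + k ≤ N) {y z : V} (hy : y ∈ outer p N)
    (hyi : Attaches G p N y i) (hyj : G.Adj (p j) y) (hz : z ∈ outer p N)
    (hzj : G.Adj (p (j + m)) z) : z = y := by
  obtain ⟨-, -, y₀, hyy, hy₀⟩ := hyi
  have hI : ∀ j ∈ Set.Ico i (i + k), j ≤ N := by simp only [Set.mem_Ico]; omega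
  have hI' : ∀ i ∈ Set.Ico (j - k) j, i ≤ N := by simp only [Set.mem_Ico]; omega
  -- Otherwise `z` is off the leg from `p j` through `y` to `p i`, and this leg, the path below `p
  -- j` and `z` yield H.
  have h1 : z = y ∨ ((G.within (outer p N)).Reachable y z ∧
      (G.within (outer p N)).dist y₀ z < (G.within (outer p N)).dist y₀ y) := by
    by_contra! hcon
    refine hH (h.isContained_of_legs hj (h.leg_of_handle hk (by omega) hy hyj hyy hy₀)
      (h.leg_down k j (by omega) (by omega)) ?_ ?_ ?_ hz hzj ?_ (notMem_image_of_outer hz hI'))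
    · rw [Set.disjoint_union_left]
      refine ⟨?_, h.disjoint_image hI hI' (by simp only [Set.mem_Ico]; omega)⟩
      rw [Set.disjoint_left]
      exact fun z hz => notMem_image_of_outer hz.1 hI'
    · rintro i' h1 h2 (h3 | h3)
      · exact notMem_outer h2 h3.1
      · exact h.notMem_image h2 hI (by simp only [Set.mem_Ico]; omega) h3
    · exact fun i' h1 h2 => h.notMem_image h2 hI' (by simp only [Set.mem_Ico]; omega)
    · rintro (h3 | h3)
      · rcases h3.2.2 with h4 | h4
        · exact hcon.1 h4
        · exact absurd h4 (not_lt.2 (hcon.2 h3.2.1))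
      · exact notMem_image_of_outer hz hI h3
  rcases h1 with h1 | ⟨hr, h1⟩
  · exact h1
  by_contra hne
  -- Now `z` is closer to `y₀` than `y`, so a shortest route from `z` avoids `y`. It serves as a leg
  -- at `p (j + m)`, while `y` is the short leg at `p j`.
  refine hH (h.isContained_of_leg_of_le (by omega) hj
    (h.leg_of_handle hk (by omega) hz hzj (hr.symm.trans hyy) hy₀) ?_ hy hyj ?_)
  · rintro i' h1 h2 (h3 | h3)
    · exact notMem_outer h2 h3.1
    · exact h.notMem_image h2 hI (by simp only [Set.mem_Ico]; omega) h3
  · rintro (h3 | h3)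
    · rcases h3.2.2 with h4 | h4
      · exact hne h4.symm
      · omega
    · exact notMem_image_of_outer hy hI h3

/-- The last vertex of the path that is adjacent to a given component of the rest starts no long
path into this component. -/
theorem length_lt_of_last (hH : ¬ (subdividedH m 1 k k k).IsContained G)
    (hdeg : ∀ v a b, ∃ y, G.Adj v y ∧ y ≠ a ∧ y ≠ b) {j : ℕ} (hkj : k ≤ j)
    (hj : j + m + k ≤ N) (hm : 1 ≤ m) {x y : V} (hx : x ∈ outer p N) (hxj : G.Adj (p j) x)
    (hlast : ∀ i, Attaches G p N x i → i ≤ j) (w : (G.within (outer p N)).Walk x y)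
    (hw : w.IsPath) : w.length < k - 1 := by
  classical
  by_contra! hlt
  obtain ⟨z, hz, hzj⟩ := h.exists_outer_adj hdeg (i := j + m) (by omega)
  have hI' : ∀ i ∈ Set.Ico (j - k) j, i ≤ N := by simp only [Set.mem_Ico]; omega
  have hout : ∀ {z}, (G.within (outer p N)).Reachable x z → z ∈ outer p N :=
    fun h => h.mem_of_within hx
  have l := Leg.of_walk_within (T := {z | (G.within (outer p N)).Reachable x z ∧ z ≠ x}) w hw
    (.nil ∅ y) (fun z hz hzx => ⟨(w.takeUntil z hz).reachable, hzx⟩) (by simp)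
  have l2 := (l.insert hxj (by simp)).of_le (m := k) (by omega)
  have l3 := l2.mono (T := {z | (G.within (outer p N)).Reachable x z}) (by
    rintro z (rfl | hz | hz)
    · exact .rfl
    · exact hz.1
    · exact hz.elim)
  refine hH (h.isContained_of_legs hj l3 (h.leg_down k j hkj (by omega)) ?_ ?_ ?_ hz hzj ?_
    (notMem_image_of_outer hz hI'))
  · rw [Set.disjoint_left]
    exact fun z hz => notMem_image_of_outer (hout hz) hI'
  · exact fun i _ hi h => notMem_outer hi (hout h)
  · exact fun i' h1 h2 => h.notMem_image h2 hI' (by simp only [Set.mem_Ico]; omega)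
  -- As `p j` is the last attachment and `m ≥ 1`, the outer neighbour `z` of `p (j + m)` lies in
  -- another component.
  · intro hr
    have := hlast (j + m) ⟨hx, by omega, z, hr, hzj⟩
    omega

end IsInducedPath

end

/-! ### Distant attachments force a protected fan. -/

section

variable {V : Type*} {G : SimpleGraph V} {p : ℕ → V} {N k m : ℕ}

namespace IsInducedPath

variable (h : IsInducedPath G p N)
include h

theorem containsProtectedFan {L n : ℕ} (hL : L + n ≤ N + 1) {y : V} (hy : y ∈ outer p N)
    (hadj : ∀ i, L ≤ i → i < L + n → G.Adj (p i) y)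
    (huniq : ∀ i, L ≤ i → i < L + n → ∀ z ∈ outer p N, G.Adj (p i) z → z = y) :
    ContainsProtectedFan G (n + 1) := by
  let φ : Option (Fin n) → V := fun o => o.elim y fun i => p (L + i)
  have hne : ∀ i ≤ N, p i ≠ y := fun i hi hiy => notMem_outer hi (hiy ▸ hy)
  have hφ : Function.Injective φ := by
    rintro (_ | i) (_ | j) hij
    · rfl
    · exact (hne _ (by omega) hij.symm).elim
    · exact (hne _ (by omega) hij).elim
    · have := h.inj _ (by omega) _ (by omega) hij
      rw [Fin.ext (show (i : ℕ) = j by omega)]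
  have hmap : ∀ a b, G.Adj (φ a) (φ b) ↔ (fanGraph n).Adj a b := by
    rintro (_ | i) (_ | j) <;> simp only [fanGraph, SimpleGraph.fromRel_adj]
    · simp
    · simpa [φ] using (hadj (L + j) (by omega) (by omega)).symm
    · simpa [φ] using hadj (L + i) (by omega) (by omega)
    · simp only [φ, Option.elim_some, h.adj _ (show L + (i : ℕ) ≤ N by omega) _
        (show L + (j : ℕ) ≤ N by omega), SimpleGraph.pathGraph_adj, ne_eq, Option.some.injEq,
        Fin.ext_iff]
      omega
  refine ⟨Set.range φ, ⟨Equiv.ofInjective φ hφ, ?_⟩, ?_⟩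
  · intro a b
    exact hmap a b
  · rintro (_ | i) hpole
    · exact absurd trivial hpole
    · simp only [IsFanPole, not_or] at hpole
      intro w hw
      have hw' : G.Adj (p (L + i)) w := hw
      by_cases hwo : w ∈ outer p N
      · exact ⟨none, (huniq _ (by omega) (by omega) w hwo hw').symm⟩
      · simp only [outer, Set.mem_ofPred_eq, not_forall, not_not] at hwo
        obtain ⟨j, hj, rfl⟩ := hwo
        rw [h.adj _ (by omega) _ hj] at hw'
        refine ⟨some ⟨j - L, by omega⟩, ?_⟩
        simp only [φ, Option.elim_some]
        congr 1
        omega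

/-- If `z ≠ y`, there is an H whose spine runs from `p (c + (m - 1))` down to `p c` and then to `y`.
The legs at `y` enter the path at `p a` and `p b`; the other end carries `z` and the path going up.
-/
theorem outer_nbr_unique_of_high (hH : ¬ (subdividedH m 1 k k k).IsContained G) (hk : 1 ≤ k)
    (hm : 1 ≤ m) {y : V} (hy : y ∈ outer p N) {a b c : ℕ} (hab : a + k ≤ b) (hbc : b + k ≤ c)
    (hc : c + m + k ≤ N) (ha : G.Adj (p a) y) (hb : G.Adj (p b) y) (hcy : G.Adj (p c) y) {z : V}
    (hz : z ∈ outer p N) (hzc : G.Adj (p (c + (m - 1))) z) : z = y := by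
  by_contra hzy
  have hI : ∀ a, a ≤ c → ∀ i ∈ Set.Ico a (a + k), i ≤ N := by
    simp only [Set.mem_Ico]; omega
  have hJ : ∀ i ∈ Set.Ico (c + (m - 1) + 1) (c + (m - 1) + 1 + k), i ≤ N := by
    simp only [Set.mem_Ico]; omega
  have hne : ∀ i ≤ N, p i ≠ y := fun i hi hiy => notMem_outer hi (hiy ▸ hy)
  have hne' : ∀ i ≤ N, p i ≠ z := fun i hi hiz => notMem_outer hi (hiz ▸ hz)
  have hσ : ∀ i ≤ m, ∀ S : Set V, y ∉ S → (∀ j, c ≤ j → j ≤ c + (m - 1) → p j ∉ S) →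
      (fun i => if i = m then y else p (c + (m - 1) - i)) i ∉ S := by
    intro i hi S h1 h2
    dsimp only
    split_ifs with him
    · exact h1
    · exact h2 _ (by omega) (by omega)
  refine hH (subdividedH_isContained (σ := fun i => if i = m then y else p (c + (m - 1) - i))
    (A := {z}) (B := p '' Set.Ico (c + (m - 1) + 1) (c + (m - 1) + 1 + k))
    (C := p '' Set.Ico a (a + k)) (D := p '' Set.Ico b (b + k)) ?_ ?_ ?_ ?_ ?_ ?_
    (fun i hi => hσ i hi _ ?_ ?_) (fun i hi => hσ i hi _ ?_ ?_) (fun i hi => hσ i hi _ ?_ ?_)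
    (fun i hi => hσ i hi _ ?_ ?_) ?_ ?_ ?_ ?_ ?_ ?_)
  · intro i hi
    by_cases him : i + 1 = m
    · simpa [him, hi.ne, show c + (m - 1) - i = c by omega] using hcy
    · simp only [hi.ne, him, if_false]
      exact (h.adj _ (by omega) _ (by omega)).2 (by omega)
  · intro i hi j hj hij
    split_ifs at hij with h1 h2 h2
    · omega
    · exact (hne _ (by omega) hij.symm).elim
    · exact (hne _ (by omega) hij).elim
    · have := h.inj _ (by omega) _ (by omega) hij
      omega
  · rw [if_neg (by omega)]
    exact .cons rfl hzc (.nil _ _)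
  · rw [if_neg (by omega)]
    exact h.leg_up k _ (by omega)
  · rw [if_pos rfl]
    exact h.leg_of_adj_up hk (by omega) ha
  · rw [if_pos rfl]
    exact h.leg_of_adj_up hk (by omega) hb
  · exact fun h => hzy h.symm
  · exact fun j _ _ => hne' j (by omega)
  · exact notMem_image_of_outer hy hJ
  · exact fun j _ _ => h.notMem_image (by omega) hJ (by simp only [Set.mem_Ico]; omega)
  · exact notMem_image_of_outer hy (hI a (by omega))
  · exact fun j _ _ => h.notMem_image (by omega) (hI a (by omega))
      (by simp only [Set.mem_Ico]; omega)
  · exact notMem_image_of_outer hy (hI b (by omega))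
  · exact fun j _ _ => h.notMem_image (by omega) (hI b (by omega))
      (by simp only [Set.mem_Ico]; omega)
  · exact Set.disjoint_singleton_left.2 (notMem_image_of_outer hz hJ)
  · exact Set.disjoint_singleton_left.2 (notMem_image_of_outer hz (hI a (by omega)))
  · exact Set.disjoint_singleton_left.2 (notMem_image_of_outer hz (hI b (by omega)))
  · exact h.disjoint_image hJ (hI a (by omega)) (by simp only [Set.mem_Ico]; omega)
  · exact h.disjoint_image hJ (hI b (by omega)) (by simp only [Set.mem_Ico]; omega)
  · exact h.disjoint_image (hI a (by omega)) (hI b (by omega)) (by simp only [Set.mem_Ico]; omega)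

/-- A component that attaches to the path at two distant places gives a protected fan. -/
theorem containsProtectedFan_of_far (hH : ¬ (subdividedH m 1 k k k).IsContained G)
    (hdeg : ∀ v a b, ∃ y, G.Adj v y ∧ y ≠ a ∧ y ≠ b) (hk : 1 ≤ k) (hm : 1 ≤ m) {i j : ℕ} {x : V}
    (hi : Attaches G p N x i) (hj : Attaches G p N x j) (hij : i + 2 * k ≤ j)
    (hjN : j + (m * (2 * k + 1 + m) + 2 * m + 2 * k) ≤ N) :
    ContainsProtectedFan G (m + k + 2) := by
  obtain ⟨hx, -, y, hxy, hjy⟩ := hj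
  have hy : y ∈ outer p N := hxy.mem_of_within hx
  have hyi : Attaches G p N y i := hi.of_reachable hxy
  have hstep : ∀ t, j + t * m + k ≤ N → G.Adj (p (j + t * m)) y ∧
      (1 ≤ t → ∀ z ∈ outer p N, G.Adj (p (j + t * m)) z → z = y) := by
    intro t
    induction t with
    | zero => exact fun _ => ⟨by simpa using hjy, by omega⟩
    | succ t ih =>
      intro ht
      have hexp : j + (t + 1) * m = j + t * m + m := by ring
      rw [hexp] at ht ⊢
      have huniq : ∀ z ∈ outer p N, G.Adj (p (j + t * m + m)) z → z = y := fun z hz hzj =>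
        h.eq_of_handle hH hk (by omega) ht hy hyi (ih (by omega)).1 hz hzj
      obtain ⟨z, hz, hzj⟩ := h.exists_outer_adj hdeg (i := j + t * m + m) (by omega)
      exact ⟨huniq z hz hzj ▸ hzj, fun _ => huniq⟩
  have hkm : k ≤ k * m := Nat.le_mul_of_pos_right _ hm
  have hbound : k * m + k * m ≤ m * (2 * k + 1 + m) := by
    nlinarith
  -- The condition `2 * k + 1 ≤ t` keeps the current vertex at distance at least `k` above `p (j + k
  -- * m)`, which together with `p j` supplies the two legs at `y`.
  have hfull : ∀ s t, 2 * k + 1 ≤ t → j + t * m + s * (m - 1) + m + k ≤ N →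
      G.Adj (p (j + t * m + s * (m - 1))) y ∧
      ∀ z ∈ outer p N, G.Adj (p (j + t * m + s * (m - 1))) z → z = y := by
    intro s t ht
    induction s with
    | zero =>
      intro hs
      simp only [Nat.zero_mul, Nat.add_zero] at hs ⊢
      exact ⟨(hstep t (by omega)).1, (hstep t (by omega)).2 (by omega)⟩
    | succ s ih =>
      intro hs
      have hexp : j + t * m + (s + 1) * (m - 1) = j + t * m + s * (m - 1) + (m - 1) := by ring
      rw [hexp] at hs ⊢
      have htm : (2 * k + 1) * m ≤ t * m := Nat.mul_le_mul_right _ ht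
      have htm' : (2 * k + 1) * m = k * m + k * m + m := by ring
      have huniq : ∀ z ∈ outer p N, G.Adj (p (j + t * m + s * (m - 1) + (m - 1))) z → z = y :=
        fun z hz hzj => h.outer_nbr_unique_of_high hH hk hm hy (a := j) (b := j + k * m)
          (by omega) (by omega) (by omega) hjy (hstep k (by omega)).1 (ih (by omega)).1 hz hzj
      obtain ⟨z, hz, hzj⟩ := h.exists_outer_adj hdeg
        (i := j + t * m + s * (m - 1) + (m - 1)) (by omega)
      exact ⟨huniq z hz hzj ▸ hzj, huniq⟩
  have hall : ∀ n, j + m * (2 * k + 1 + m) ≤ n → n + m + k ≤ N →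
      G.Adj (p n) y ∧ ∀ z ∈ outer p N, G.Adj (p n) z → z = y := by
    intro n hn hnN
    obtain ⟨d, rfl⟩ : ∃ d, n = j + d := ⟨n - j, by omega⟩
    -- Rounding `d` up to `q * m` overshoots by `s < m`, so `d` consists of `q - s` steps of `m` and
    -- `s` steps of `m - 1`.
    obtain ⟨q, s, hqs, hs⟩ : ∃ q s, q * m = d + s ∧ s < m := by
      refine ⟨(d + (m - 1)) / m, (m - 1) - (d + (m - 1)) % m, ?_, by omega⟩
      have h1 := Nat.div_add_mod' (d + (m - 1)) m
      have h2 := Nat.mod_lt (d + (m - 1)) hm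
      omega
    have hq : 2 * k + 1 + m ≤ q := by
      have : m * (2 * k + 1 + m) ≤ m * q := by rw [Nat.mul_comm m q]; omega
      exact Nat.le_of_mul_le_mul_left this hm
    have hexp : j + (q - s) * m + s * (m - 1) = j + d := by
      obtain ⟨t, rfl⟩ : ∃ t, q = t + s := ⟨q - s, by omega⟩
      obtain ⟨m', rfl⟩ : ∃ m', m = m' + 1 := ⟨m - 1, by omega⟩
      simp only [Nat.add_sub_cancel]
      have : (t + s) * (m' + 1) = t * (m' + 1) + s * m' + s := by ring
      omega
    have := hfull s (q - s) (by omega) (by omega)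
    rwa [hexp] at this
  exact h.containsProtectedFan (L := j + m * (2 * k + 1 + m)) (n := m + k + 1) (by omega) hy
    (fun i h1 h2 => (hall i h1 (by omega)).1) (fun i h1 h2 => (hall i h1 (by omega)).2)

omit h in
theorem outer_reverse : outer (fun i => p (N - i)) N = outer p N := by
  ext x
  constructor
  · intro hx i hi hxi
    exact hx (N - i) (by omega) (by simpa [Nat.sub_sub_self hi] using hxi)
  · exact fun hx i hi => hx (N - i) (by omega)

omit h in
theorem attaches_reverse {x : V} {i : ℕ} (hx : Attaches G p N x i) :
    Attaches G (fun i => p (N - i)) N x (N - i) := by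
  obtain ⟨h1, h2, y, h3, h4⟩ := hx
  refine ⟨by rwa [outer_reverse], by omega, y, by rwa [outer_reverse], ?_⟩
  simpa [Nat.sub_sub_self h2] using h4

/-- The fan is built from `p i` in the direction away from `p j`, by reversing the path if
necessary. Hence room is needed only around `i`, and `j` is arbitrary. -/
theorem attaches_near (hH : ¬ (subdividedH m 1 k k k).IsContained G)
    (hF : ¬ ContainsProtectedFan G (m + k + 2))
    (hdeg : ∀ v a b, ∃ y, G.Adj v y ∧ y ≠ a ∧ y ≠ b) (hk : 1 ≤ k) (hm : 1 ≤ m) {i j : ℕ} {x : V}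
    (hi : Attaches G p N x i) (hj : Attaches G p N x j)
    (hi1 : m * (2 * k + 1 + m) + 2 * m + 2 * k ≤ i)
    (hi2 : i + (m * (2 * k + 1 + m) + 2 * m + 2 * k) ≤ N) : j < i + 2 * k ∧ i < j + 2 * k := by
  constructor
  · by_contra! hlt
    have := hj.2.1
    exact hF (h.reverse.containsProtectedFan_of_far hH hdeg hk hm (attaches_reverse hj)
      (attaches_reverse hi) (by omega) (by omega))
  · by_contra! hlt
    exact hF (h.containsProtectedFan_of_far hH hdeg hk hm hj hi hlt hi2)

end IsInducedPath

end

/-! ### Straddling components. -/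

/-- The component of the vertex `x` off the path attaches to the path at `i` and `j`, which are
close to each other and on different sides of `s`. -/
structure Straddles {V : Type*} (G : SimpleGraph V) (p : ℕ → V) (N k : ℕ) (x : V)
    (i j s : ℕ) : Prop where
  left : Attaches G p N x i
  right : Attaches G p N x j
  left_lt : i < s
  lt_right : s < j
  near : j < i + 2 * k

section

variable {V : Type*} {G : SimpleGraph V} {p : ℕ → V} {N k m : ℕ}

theorem Straddles.exists_max {x : V} {i j s : ℕ} (hs : Straddles G p N k x i j s) :
    ∃ x i j, Straddles G p N k x i j s ∧ ∀ x' i' j', Straddles G p N k x' i' j' s → j' ≤ j := by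
  classical
  obtain ⟨x₁, i₁, h₁⟩ := Nat.findGreatest_spec (P := fun j => ∃ x i, Straddles G p N k x i j s)
    hs.right.2.1 ⟨x, i, hs⟩
  exact ⟨x₁, i₁, _, h₁, fun x' i' j' h' => Nat.le_findGreatest h'.right.2.1 ⟨x', i', h'⟩⟩

namespace IsInducedPath

variable (h : IsInducedPath G p N)
include h

theorem leg_down_append {b n : ℕ} {S : Set V} (l : Leg G S (p b) n) (d : ℕ) (hd : b + d ≤ N)
    (hS : ∀ i, b ≤ i → i < b + d → p i ∉ S) :
    Leg G (p '' Set.Ico b (b + d) ∪ S) (p (b + d)) (n + d) := by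
  induction d with
  | zero => simpa using l
  | succ d ih =>
    refine ((ih (by omega) fun i h1 h2 => hS i h1 (by omega)).insert (v := p (b + (d + 1)))
      ((h.adj _ (by omega) _ (by omega)).2 (by omega)) ?_).mono ?_
    · rintro (h1 | h1)
      · exact h.notMem_image (by omega) (by simp only [Set.mem_Ico]; omega) (by simp) h1
      · exact hS _ (by omega) (by omega) h1
    · rintro _ (rfl | ⟨i, hi, rfl⟩ | h1)
      · exact .inl ⟨b + d, by simp only [Set.mem_Ico]; omega, rfl⟩
      · exact .inl ⟨i, by simp only [Set.mem_Ico] at *; omega, rfl⟩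
      · exact .inr h1

omit h in
theorem leg_through {x : V} {i j n : ℕ} {S : Set V} (hi : Attaches G p N x i)
    (hj : Attaches G p N x j) (l : Leg G S (p i) n) (hiS : p i ∉ S)
    (hS : ∀ z, (G.within (outer p N)).Reachable x z → z ∉ S) :
    Leg G ({z | (G.within (outer p N)).Reachable x z} ∪ Insert.insert (p i) S) (p j) (n + 2) := by
  obtain ⟨hx, hiN, y, hxy, hiy⟩ := hi
  obtain ⟨-, -, z, hxz, hjz⟩ := hj
  obtain ⟨w, hw⟩ := (hxz.symm.trans hxy).exists_isPath
  have hd : ∀ u, (G.within (outer p N)).Reachable x u → u ∉ Insert.insert (p i) S := by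
    rintro u hu (rfl | hu')
    · exact notMem_outer hiN (hu.mem_of_within hx)
    · exact hS u hu hu'
  have l2 := Leg.of_walk_within (T := {u | (G.within (outer p N)).Reachable x u ∧ u ≠ z}) w hw
    (l.insert hiy.symm hiS) (fun u hu huz => ⟨by
      classical exact hxz.trans (w.takeUntil u hu).reachable, huz⟩)
    (Set.disjoint_left.2 fun u hu => hd u hu.1)
  refine ((l2.insert hjz ?_).of_le (by omega)).mono ?_
  · rintro (h1 | h1)
    · exact h1.2 rfl
    · exact hd z hxz h1
  · rintro u (rfl | h1 | h1)
    · exact .inl hxz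
    · exact .inl h1.1
    · exact .inr h1

/-- Two disjoint paths running to the left through a chain of overlapping straddling components. -/
theorem exists_two_legs {lo hi b₀ : ℕ} (hhi : hi ≤ N)
    (hnear : ∀ x i j, lo ≤ i → i ≤ hi → Attaches G p N x i → Attaches G p N x j →
      j < i + 2 * k ∧ i < j + 2 * k) (hlo : lo + 2 * k ≤ b₀) (n : ℕ) :
    b₀ + 2 * k * (n + 1) ≤ hi →
    (∀ s, b₀ ≤ s → s ≤ b₀ + 2 * k * n → ∃ x i j, Straddles G p N k x i j s) →
    ∃ (b c : ℕ) (A B : Set V), b₀ ≤ b ∧ b < c ∧ c ≤ b₀ + 2 * k * (n + 1) ∧ Disjoint A B ∧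
      Leg G A (p b) n ∧ Leg G B (p c) (n + 1) ∧
      (∀ z ∈ A ∪ B, (∃ i < b, z = p i) ∨ (z ∈ outer p N ∧ ∀ i, Attaches G p N z i → i ≤ c)) ∧
      ∀ x i j, Straddles G p N k x i j b → j ≤ c := by
  -- By locality, the rightmost attachment among all components straddling `s` is also the last
  -- attachment of its own component.
  have hmax : ∀ {x i j s}, b₀ ≤ s → s ≤ hi → Straddles G p N k x i j s →
      (∀ x' i' j', Straddles G p N k x' i' j' s → j' ≤ j) →
      ∀ j', Attaches G p N x j' → j' ≤ j := by
    intro x i j s hbs hsi hs hs' j' hj'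
    by_contra! hlt
    have h1 := hs.left_lt
    have h2 := hs.lt_right
    have h3 := hs.near
    exact absurd (hs' x i j' ⟨hs.left, hj', h1, by omega,
      (hnear x i j' (by omega) (by omega) hs.left hj').1⟩) (by omega)
  induction n with
  | zero =>
    intro hb hstr
    obtain ⟨x, i, j, hs⟩ := hstr b₀ le_rfl (by omega)
    obtain ⟨x, i, j, hs, hs'⟩ := hs.exists_max
    have h1 := hs.left_lt
    have h2 := hs.lt_right
    have h3 := hs.near
    refine ⟨b₀, j, ∅, _, le_rfl, h2, by omega, Set.empty_disjoint _, .nil _ _,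
      (leg_through hs.left hs.right (.nil ∅ _) (by simp) (by simp)).of_le (by omega), ?_, hs'⟩
    rintro z (hz | hz | rfl | hz)
    · exact hz.elim
    · exact .inr ⟨hz.mem_of_within hs.left.1, fun i' hi' =>
        hmax le_rfl (by omega) hs hs' i' (hi'.of_reachable hz.symm)⟩
    · exact .inl ⟨i, h1, rfl⟩
    · exact hz.elim
  | succ n ih =>
    intro hb hstr
    have hexp : 2 * k * (n + 1) = 2 * k * n + 2 * k := by ring
    have hexp' : 2 * k * (n + 1 + 1) = 2 * k * n + 2 * k + 2 * k := by ring
    obtain ⟨b, c, A, B, hb₀, hbc, hc, hAB, lA, lB, hmem, hgreedy⟩ :=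
      ih (by omega) fun s h1 h2 => hstr s h1 (by omega)
    obtain ⟨x, i, j, hs⟩ := hstr c (by omega) (by omega)
    obtain ⟨x, i, j, hs, hs'⟩ := hs.exists_max
    have h1 := hs.left_lt
    have h2 := hs.lt_right
    have h3 := hs.near
    have hjN := hs.right.2.1
    -- The greedy choice at `b`: a component attaching to the left of `b` and at `j > c` would have
    -- been a better one.
    have hbi : b ≤ i := by
      by_contra! hlt
      have := hgreedy x i j ⟨hs.left, hs.right, hlt, by omega, h3⟩
      omega
    have hpA : ∀ t, b ≤ t → t ≤ N → p t ∉ A ∪ B := by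
      intro t hbt htN ht
      rcases hmem _ ht with ⟨t', ht', htt⟩ | ⟨ht', -⟩
      · have := h.inj _ htN _ (by omega) htt
        omega
      · exact notMem_outer htN ht'
    have hxA : ∀ z, (G.within (outer p N)).Reachable x z → z ∉ A ∪ B := by
      intro z hxz hz
      rcases hmem _ hz with ⟨t', ht', htt⟩ | ⟨-, hz'⟩
      · subst htt
        exact notMem_outer (by omega) (hxz.mem_of_within hs.left.1)
      · have := hz' j (hs.right.of_reachable hxz)
        omega
    obtain ⟨d, rfl⟩ : ∃ d, i = b + d := ⟨i - b, by omega⟩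
    have l1 := h.leg_down_append lA d (by omega) fun t ht ht' hA => hpA t ht (by omega) (.inl hA)
    have l2 := leg_through hs.left hs.right l1 (by
      rintro (h4 | h4)
      · exact h.notMem_image (by omega) (by simp only [Set.mem_Ico]; omega) (by simp) h4
      · exact hpA _ (by omega) (by omega) (.inl h4)) (by
      rintro z hxz (h4 | h4)
      · exact notMem_image_of_outer (hxz.mem_of_within hs.left.1)
          (by simp only [Set.mem_Ico]; omega) h4
      · exact hxA z hxz (.inl h4))
    -- The legs swap roles: `B` stays at `p c`, while the leg from `p j` passes through the new
    -- component to `p i`, down the path to `p b` and along `A`. The new component attaches beyond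
    -- `c`, so neither old leg uses it.
    refine ⟨c, j, B, _, by omega, h2, by omega, ?_, lB, l2.of_le (by omega), ?_, hs'⟩
    · rw [Set.disjoint_right]
      rintro z (hz | rfl | ⟨t, ht, rfl⟩ | hz) hzB
      · exact hxA z hz (.inr hzB)
      · exact hpA _ (by omega) (by omega) (.inr hzB)
      · simp only [Set.mem_Ico] at ht
        exact hpA _ (by omega) (by omega) (.inr hzB)
      · exact Set.disjoint_left.1 hAB hz hzB
    · have hmem' : ∀ z ∈ A ∪ B,
          (∃ i < c, z = p i) ∨ (z ∈ outer p N ∧ ∀ i, Attaches G p N z i → i ≤ j) := by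
        intro z hz
        rcases hmem z hz with ⟨t, ht, rfl⟩ | ⟨hz1, hz2⟩
        · exact .inl ⟨t, by omega, rfl⟩
        · exact .inr ⟨hz1, fun t ht => (hz2 t ht).trans h2.le⟩
      rintro z (hz | hz | rfl | ⟨t, ht, rfl⟩ | hz)
      · exact hmem' z (.inr hz)
      · exact .inr ⟨hz.mem_of_within hs.left.1, fun i' hi' =>
          hmax (by omega) (by omega) hs hs' i' (hi'.of_reachable hz.symm)⟩
      · exact .inl ⟨_, h1, rfl⟩
      · simp only [Set.mem_Ico] at ht
        exact .inl ⟨t, by omega, rfl⟩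
      · exact hmem' z (.inl hz)

/-- In every window of sufficient length some vertex of the path is not straddled. -/
theorem exists_not_straddled (hH : ¬ (subdividedH m 1 k k k).IsContained G)
    (hdeg : ∀ v a b, ∃ y, G.Adj v y ∧ y ≠ a ∧ y ≠ b) (hk : 1 ≤ k) (hm : 1 ≤ m)
    {lo hi b₀ : ℕ} (hhi : hi + m + k ≤ N)
    (hnear : ∀ x i j, lo ≤ i → i ≤ hi → Attaches G p N x i → Attaches G p N x j →
      j < i + 2 * k ∧ i < j + 2 * k) (hlo : lo + 2 * k ≤ b₀) (hb : b₀ + 2 * k * k ≤ hi) :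
    ∃ s, b₀ ≤ s ∧ s ≤ b₀ + 2 * k * k ∧ ∀ x i j, ¬ Straddles G p N k x i j s := by
  by_contra! hcon
  have hkk : 2 * k * (k - 1) ≤ 2 * k * k := Nat.mul_le_mul_left _ (by omega)
  obtain ⟨b, c, A, B, hb₀, hbc, hc, hAB, lA, lB, hmem, -⟩ :=
    h.exists_two_legs (by omega) hnear hlo (k - 1) (by rwa [Nat.sub_add_cancel hk])
      fun s h1 h2 => hcon s h1 (by omega)
  rw [Nat.sub_add_cancel hk] at lB hc
  have hpA : ∀ t, b ≤ t → t ≤ N → p t ∉ A ∪ B := by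
    intro t hbt htN ht
    rcases hmem _ ht with ⟨t', ht', htt⟩ | ⟨ht', -⟩
    · have := h.inj _ htN _ (by omega) htt
      omega
    · exact notMem_outer htN ht'
  obtain ⟨d, rfl⟩ : ∃ d, c = b + d := ⟨c - b, by omega⟩
  -- Walking from `p c` down to `p b` gains the edge missing from the leg at `p b`, so both legs now
  -- start at `p c`.
  have lA' := (h.leg_down_append lA d (by omega)
    fun t ht ht' hA => hpA t ht (by omega) (.inl hA)).of_le (m := k) (by omega)
  obtain ⟨z, hz, hzj⟩ := h.exists_outer_adj hdeg (i := b + d + m) (by omega)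
  have hI : ∀ i ∈ Set.Ico b (b + d), i ≤ N := by simp only [Set.mem_Ico]; omega
  have hzA : z ∉ A ∪ B := by
    intro hz'
    rcases hmem _ hz' with ⟨t', ht', htt⟩ | ⟨-, hz''⟩
    · exact hz t' (by omega) htt
    · have := hz'' _ (.of_adj hz (by omega) hzj)
      omega
  refine hH (h.isContained_of_legs (by omega) lA' lB ?_ ?_ ?_ hz hzj ?_
    fun h => hzA (.inr h))
  · rw [Set.disjoint_left]
    rintro _ (⟨t, ht, rfl⟩ | hA) hB
    · exact hpA t ht.1 (hI t ht) (.inr hB)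
    · exact Set.disjoint_left.1 hAB hA hB
  · rintro i h1 h2 (h3 | h3)
    · exact h.notMem_image h2 hI (by simp only [Set.mem_Ico]; omega) h3
    · exact hpA i (by omega) h2 (.inl h3)
  · exact fun i h1 h2 h3 => hpA i (by omega) h2 (.inr h3)
  · rintro (h3 | h3)
    · exact notMem_image_of_outer hz hI h3
    · exact hzA (.inl h3)

end IsInducedPath

end

/-! ### Cutting out a segment and bounding its treedepth. -/

section

variable {V : Type u} {G : SimpleGraph V} {p : ℕ → V} {N k m : ℕ}

theorem Attaches.exists_max {x : V} {i : ℕ} (hx : Attaches G p N x i) :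
    ∃ j, Attaches G p N x j ∧ ∀ i, Attaches G p N x i → i ≤ j := by
  classical
  exact ⟨_, Nat.findGreatest_spec (P := fun j => Attaches G p N x j) hx.2.1 hx,
    fun i' h' => Nat.le_findGreatest h'.2.1 h'⟩

namespace IsInducedPath

variable (h : IsInducedPath G p N)
include h

/-- If `s₀` itself fails, every component attaching at `s₀` also attaches to its left. A component
attaching at or before `s₀` and at or after `s₀ + 1` would then give a component straddling `s₀`, so
`s₀ + 1` works. -/
theorem exists_left_end (hdeg : ∀ v a b, ∃ y, G.Adj v y ∧ y ≠ a ∧ y ≠ b) {lo hi s₀ : ℕ}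
    (hhi : hi ≤ N)
    (hnear : ∀ x i j, lo ≤ i → i ≤ hi → Attaches G p N x i → Attaches G p N x j →
      j < i + 2 * k ∧ i < j + 2 * k) (hlo : lo + 2 * k ≤ s₀) (hs₀ : s₀ + 1 ≤ hi)
    (hstr : ∀ x i j, ¬ Straddles G p N k x i j s₀) :
    ∃ s, s₀ ≤ s ∧ s ≤ s₀ + 1 ∧ (∀ x i j, ¬ Straddles G p N k x i j s) ∧
      ∃ y ∈ outer p N, G.Adj (p s) y ∧ ∀ i, Attaches G p N y i → s ≤ i := by
  by_cases hgood : ∃ y ∈ outer p N, G.Adj (p s₀) y ∧ ∀ i, Attaches G p N y i → s₀ ≤ i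
  · exact ⟨s₀, le_rfl, by omega, hstr, hgood⟩
  push Not at hgood
  have hgood' : ∀ x, Attaches G p N x s₀ → ∃ i < s₀, Attaches G p N x i := by
    rintro x ⟨hx, -, y, hxy, hy⟩
    obtain ⟨i, hi, hi'⟩ := hgood y (hxy.mem_of_within hx) hy
    exact ⟨i, hi', hi.of_reachable hxy.symm⟩
  have hleft : ∀ x i j, Attaches G p N x i → Attaches G p N x j → i < s₀ + 1 → s₀ + 1 ≤ j →
      j < i + 2 * k → False := by
    intro x i j hi hj his hsj hn
    rcases Nat.lt_succ_iff_lt_or_eq.1 his with h1 | rfl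
    · exact hstr x i j ⟨hi, hj, h1, by omega, hn⟩
    · obtain ⟨i', hi', hi''⟩ := hgood' x hi
      have := hnear x i i' (by omega) (by omega) hi hi''
      exact hstr x i' j ⟨hi'', hj, hi', by omega, (hnear x i' j (by omega) (by omega) hi'' hj).1⟩
  refine ⟨s₀ + 1, by omega, le_rfl, fun x i j hs => hleft x i j hs.left hs.right hs.left_lt
    hs.lt_right.le hs.near, ?_⟩
  obtain ⟨y, hy, hya⟩ := h.exists_outer_adj hdeg (i := s₀ + 1) (by omega)
  refine ⟨y, hy, hya, fun i hi => ?_⟩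
  by_contra! hlt
  have hatt := Attaches.of_adj hy (by omega) hya
  exact hleft y i (s₀ + 1) hi hatt hlt le_rfl
    (hnear y (s₀ + 1) i (by omega) (by omega) hatt hi).2

theorem exists_right_end (hdeg : ∀ v a b, ∃ y, G.Adj v y ∧ y ≠ a ∧ y ≠ b) {lo hi t₀ : ℕ}
    (hhi : hi ≤ N)
    (hnear : ∀ x i j, lo ≤ i → i ≤ hi → Attaches G p N x i → Attaches G p N x j →
      j < i + 2 * k ∧ i < j + 2 * k) (hlo : lo + 2 * k + 1 ≤ t₀) (ht₀ : t₀ ≤ hi)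
    (hstr : ∀ x i j, ¬ Straddles G p N k x i j t₀) :
    ∃ t, t₀ ≤ t + 1 ∧ t ≤ t₀ ∧ (∀ x i j, ¬ Straddles G p N k x i j t) ∧
      ∃ y ∈ outer p N, G.Adj (p t) y ∧ ∀ i, Attaches G p N y i → i ≤ t := by
  by_cases hgood : ∃ y ∈ outer p N, G.Adj (p t₀) y ∧ ∀ i, Attaches G p N y i → i ≤ t₀
  · exact ⟨t₀, by omega, le_rfl, hstr, hgood⟩
  push Not at hgood
  have hgood' : ∀ x, Attaches G p N x t₀ → ∃ i, t₀ < i ∧ Attaches G p N x i := by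
    rintro x ⟨hx, -, y, hxy, hy⟩
    obtain ⟨i, hi, hi'⟩ := hgood y (hxy.mem_of_within hx) hy
    exact ⟨i, hi', hi.of_reachable hxy.symm⟩
  have hright : ∀ x i j, Attaches G p N x i → Attaches G p N x j → i ≤ t₀ - 1 → t₀ - 1 < j →
      j < i + 2 * k → False := by
    intro x i j hi hj his hsj hn
    rcases (show t₀ < j ∨ j = t₀ by omega) with h1 | rfl
    · exact hstr x i j ⟨hi, hj, by omega, h1, hn⟩
    · obtain ⟨j', hj', hj''⟩ := hgood' x hj
      have := hnear x j i (by omega) (by omega) hj hi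
      exact hstr x i j' ⟨hi, hj'', by omega, hj', (hnear x i j' (by omega) (by omega) hi hj'').1⟩
  refine ⟨t₀ - 1, by omega, by omega, fun x i j hs => hright x i j hs.left hs.right
    hs.left_lt.le hs.lt_right hs.near, ?_⟩
  obtain ⟨y, hy, hya⟩ := h.exists_outer_adj hdeg (i := t₀ - 1) (by omega)
  refine ⟨y, hy, hya, fun i hi => ?_⟩
  by_contra! hlt
  have hatt := Attaches.of_adj hy (by omega) hya
  exact hright y (t₀ - 1) i hatt hi le_rfl hlt
    (hnear y (t₀ - 1) i (by omega) (by omega) hatt hi).1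

/-- The segment of an induced path, as a walk. -/
theorem exists_walk (d : ℕ) : ∀ s t, t = s + d → t ≤ N →
    ∃ w : G.Walk (p s) (p t), w.length = d ∧ ∀ i ≤ d, w.getVert i = p (s + i) := by
  induction d with
  | zero =>
    rintro s t rfl hs
    exact ⟨.nil, rfl, fun i hi => by simp [show i = 0 by omega]⟩
  | succ d ih =>
    rintro s t hst ht
    obtain ⟨w, hw, hw'⟩ := ih (s + 1) t (by omega) ht
    refine ⟨.cons ((h.adj _ (by omega) _ (by omega)).2 (.inl rfl)) w, by simp [hw], ?_⟩
    rintro (_ | i) hi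
    · simp
    · rw [SimpleGraph.Walk.getVert_cons_succ, hw' i (by omega)]
      congr 1
      omega

theorem exists_induced_walk {s t : ℕ} (hst : s ≤ t) (ht : t ≤ N) :
    ∃ w : G.Walk (p s) (p t), w.IsPath ∧ w.toSubgraph.IsInduced ∧
      (∀ v ∈ w.support, ∃ i, s ≤ i ∧ i ≤ t ∧ v = p i) ∧ w.length = t - s := by
  obtain ⟨w, hw, hw'⟩ := h.exists_walk (t - s) s t (by omega) ht
  have hsupp : ∀ v ∈ w.support, ∃ i ≤ t - s, v = w.getVert i := by
    intro v hv
    obtain ⟨i, rfl, hi⟩ := SimpleGraph.Walk.mem_support_iff_exists_getVert.1 hv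
    exact ⟨i, by omega, rfl⟩
  refine ⟨w, ?_, ?_, ?_, hw⟩
  · rw [← SimpleGraph.Walk.IsPath.getVert_injOn_iff]
    intro i hi j hj hij
    have hi' : i ≤ t - s := hw ▸ hi
    have hj' : j ≤ t - s := hw ▸ hj
    rw [hw' i hi', hw' j hj'] at hij
    have := h.inj _ (by omega) _ (by omega) hij
    omega
  · intro a ha b hb hab
    obtain ⟨i, hi, rfl⟩ := hsupp _ ((w.mem_verts_toSubgraph).1 ha)
    obtain ⟨j, hj, rfl⟩ := hsupp _ ((w.mem_verts_toSubgraph).1 hb)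
    rw [hw' i hi, hw' j hj, h.adj _ (by omega) _ (by omega)] at hab
    rcases hab with hab | hab
    · obtain rfl : j = i + 1 := by omega
      exact w.toSubgraph_adj_getVert (by omega)
    · obtain rfl : i = j + 1 := by omega
      exact (w.toSubgraph_adj_getVert (by omega)).symm
  · intro v hv
    obtain ⟨i, hi, rfl⟩ := hsupp v hv
    exact ⟨s + i, by omega, by omega, hw' i hi⟩

end IsInducedPath

/-- The vertices strictly between `p s` and `p t` on the path, together with the components of
the rest that attach only to vertices between `p s` and `p t`. -/
def segmentVerts (G : SimpleGraph V) (p : ℕ → V) (N s t : ℕ) : Set V :=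
  {v | (∃ i, s < i ∧ i < t ∧ v = p i) ∨ (v ∈ outer p N ∧ (∃ i, Attaches G p N v i) ∧
    ∀ i, Attaches G p N v i → s ≤ i ∧ i ≤ t)}

/-- The inner path vertices go on top of the forest. Below them, each component is searched from a
neighbour of its last attachment, where `length_lt_of_last` limits paths to `k - 1` vertices. -/
theorem IsInducedPath.treedepth_segment_le [Finite V] (h : IsInducedPath G p N)
    (hH : ¬ (subdividedH m 1 k k k).IsContained G)
    (hdeg : ∀ v a b, ∃ y, G.Adj v y ∧ y ≠ a ∧ y ≠ b) (hm : 1 ≤ m) {s t : ℕ} (hks : k ≤ s)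
    (ht : t + m + k ≤ N) :
    treedepth ((⊤ : G.Subgraph).induce (segmentVerts G p N s t)).coe ≤ (t - s - 1) + (k - 1) := by
  classical
  set G' := (⊤ : G.Subgraph).induce (segmentVerts G p N s t)
  let Xs : Set G'.verts := {v | ∃ i, s < i ∧ i < t ∧ (v : V) = p i}
  let X : Finset G'.verts := (Set.toFinite Xs).toFinset
  have hX : ∀ v : G'.verts, v ∈ X ↔ ∃ i, s < i ∧ i < t ∧ (v : V) = p i := fun v => by
    simp [X, Xs]
  have hXc : X.card ≤ t - s - 1 := by
    rw [← Finset.card_map (Function.Embedding.subtype _), ← Nat.card_Ioo]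
    refine (Finset.card_le_card (t := (Finset.Ioo s t).image p) ?_).trans Finset.card_image_le
    intro v hv
    obtain ⟨v', hv', rfl⟩ := Finset.mem_map.1 hv
    obtain ⟨i, h1, h2, h3⟩ := (hX v').1 hv'
    exact Finset.mem_image.2 ⟨i, Finset.mem_Ioo.2 ⟨h1, h2⟩, h3.symm⟩
  let Q := G'.coe.induce (X : Set G'.verts)ᶜ
  let val : ((X : Set G'.verts)ᶜ : Set G'.verts) → V := fun v => v.1.1
  have hval : ∀ v, val v ∈ outer p N ∧ (∃ i, Attaches G p N (val v) i) ∧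
      ∀ i, Attaches G p N (val v) i → s ≤ i ∧ i ≤ t := by
    rintro ⟨⟨v, hv | hv⟩, hvX⟩
    · exact absurd ((hX _).2 hv) hvX
    · exact hv
  have hadj : ∀ v w, Q.Adj v w ↔ G.Adj (val v) (val w) := by
    rintro ⟨⟨v, hv⟩, hv'⟩ ⟨⟨w, hw⟩, hw'⟩
    exact ⟨fun h => h.2.2, fun h => ⟨hv, hw, h⟩⟩
  -- `Q` is a union of whole components off the path, so a root found in such a component lies in
  -- the matching component of `Q`.
  have hlift : ∀ {a b} (w : (G.within (outer p N)).Walk a b) (v), val v = a →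
      ∃ v', val v' = b ∧ Q.Reachable v v' := by
    intro a b w
    induction w with
    | nil => exact fun v hv => ⟨v, hv, .rfl⟩
    | @cons a b c hab w ih =>
      rintro v rfl
      obtain ⟨h1, ⟨i, h2⟩, h3⟩ := hval v
      have hb : b ∈ segmentVerts G p N s t := .inr ⟨hab.2.2, ⟨i, h2.of_reachable hab.reachable⟩,
        fun j hj => h3 j (hj.of_reachable hab.symm.reachable)⟩
      have hbX : (⟨b, hb⟩ : G'.verts) ∉ X := by
        rw [hX]
        rintro ⟨i, h4, h5, h6⟩
        exact hab.2.2 i (by omega) h6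
      obtain ⟨v', hv', hr⟩ := ih ⟨⟨b, hb⟩, hbX⟩ rfl
      exact ⟨v', hv', (SimpleGraph.Adj.reachable ((hadj _ _).2 hab.1)).trans hr⟩
  have hroot : ∀ c : Q.ConnectedComponent, ∃ y, Q.connectedComponentMk y = c ∧
      ∃ j, s ≤ j ∧ j ≤ t ∧ G.Adj (p j) (val y) ∧ ∀ i, Attaches G p N (val y) i → i ≤ j := by
    intro c
    induction c using SimpleGraph.ConnectedComponent.ind with | _ v
    obtain ⟨-, ⟨i, hi⟩, hst⟩ := hval v
    obtain ⟨j, hj, hmax⟩ := hi.exists_max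
    obtain ⟨-, -, y, ⟨w⟩, hy⟩ := id hj
    obtain ⟨v', rfl, hr⟩ := hlift w v rfl
    exact ⟨v', SimpleGraph.ConnectedComponent.sound hr.symm, j, (hst j hj).1, (hst j hj).2, hy,
      fun i hi => hmax i (hi.of_reachable w.reachable.symm)⟩
  choose f hf j hsj hjt hfj hmax using hroot
  let ψ : Q →g G.within (outer p N) :=
    ⟨val, fun {v w} hvw => ⟨(hadj v w).1 hvw, (hval v).1, (hval w).1⟩⟩
  have hψ : Function.Injective ψ := fun v w hvw => Subtype.ext (Subtype.ext hvw)
  have hpath : ∀ c w (q : Q.Walk (f c) w), q.IsPath → q.length < k - 1 := by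
    intro c w q hq
    have := h.length_lt_of_last hH hdeg (j := j c) (hks.trans (hsj c))
      (by have := hjt c; omega) hm (hval (f c)).1 (hfj c) (hmax c) (q.map ψ) (hq.map hψ)
    rwa [SimpleGraph.Walk.length_map] at this
  obtain ⟨F, -, hF⟩ := EliminationForest.exists_of_root (k - 1) Q
    (fun v => f (Q.connectedComponentMk v))
    (fun v => SimpleGraph.ConnectedComponent.exact (hf _).symm)
    (fun a b hab => by rw [SimpleGraph.ConnectedComponent.sound hab.reachable])
    (fun v w q hq => hpath _ w q hq)
  exact (treedepth_le_card_add X F hF).trans (by omega)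

/-- As neither `s` nor `t` is straddled, a component attaching strictly between them attaches
nowhere outside, so the boundary is `{p s, p t}`. By locality and `s + 2 * k ≤ t`, the components of
`y` and `z` belong to the segment; they supply second neighbours for `p s` and `p t`. -/
theorem IsInducedPath.isLType_segment [Finite V] (h : IsInducedPath G p N)
    (hH : ¬ (subdividedH m 1 k k k).IsContained G)
    (hdeg : ∀ v a b, ∃ y, G.Adj v y ∧ y ≠ a ∧ y ≠ b) (hk : 1 ≤ k) (hm : 1 ≤ m)
    {lo hi s t c : ℕ} (hnear : ∀ x i j, lo ≤ i → i ≤ hi → Attaches G p N x i →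
      Attaches G p N x j → j < i + 2 * k ∧ i < j + 2 * k) (hlo : lo ≤ s) (hhi : t ≤ hi)
    (hks : k ≤ s) (ht : t + m + k ≤ N) (hst : s + m + 2 * k ≤ t)
    (hs : ∀ x i j, ¬ Straddles G p N k x i j s) (ht' : ∀ x i j, ¬ Straddles G p N k x i j t)
    {y z : V} (hy : y ∈ outer p N) (hsy : G.Adj (p s) y) (hy' : ∀ i, Attaches G p N y i → s ≤ i)
    (hz : z ∈ outer p N) (htz : G.Adj (p t) z) (hz' : ∀ i, Attaches G p N z i → i ≤ t)
    (hc : (t - s - 1) + (k - 1) ≤ c) :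
    IsLType G ((⊤ : G.Subgraph).induce (segmentVerts G p N s t)) c (m + k) := by
  have hsN : Attaches G p N y s := .of_adj hy (by omega) hsy
  have htN : Attaches G p N z t := .of_adj hz (by omega) htz
  have hyS : y ∈ segmentVerts G p N s t := .inr ⟨hy, ⟨s, hsN⟩, fun i hi =>
    ⟨hy' i hi, by have := (hnear y s i hlo (by omega) hsN hi).1; omega⟩⟩
  have hzS : z ∈ segmentVerts G p N s t := .inr ⟨hz, ⟨t, htN⟩, fun i hi =>
    ⟨by have := (hnear z t i (by omega) hhi htN hi).2; omega, hz' i hi⟩⟩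
  have hpS : ∀ i, s < i → i < t → p i ∈ segmentVerts G p N s t := fun i h1 h2 =>
    .inl ⟨i, h1, h2, rfl⟩
  have hpS' : ∀ i ≤ N, p i ∈ segmentVerts G p N s t → s < i ∧ i < t := by
    rintro i hi (⟨j, h1, h2, h3⟩ | ⟨h1, -⟩)
    · rw [h.inj i hi j (by omega) h3]
      exact ⟨h1, h2⟩
    · exact (notMem_outer hi h1).elim
  have hne : p s ≠ p t := fun hst' => by
    have := h.inj _ (by omega) _ (by omega) hst'
    omega
  have hout : ∀ {v}, v ∈ outer p N → ∀ i ≤ N, p i ≠ v := fun hv i hi hiv => hv i hi hiv.symm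
  obtain ⟨w, hw1, hw2, hw3, hw4⟩ := h.exists_induced_walk (s := s) (t := t) (by omega) (by omega)
  refine ⟨(h.treedepth_segment_le hH hdeg hm hks ht).trans hc, p s, p t, hne,
    ⟨?_, ?_, ?_, ?_⟩, w, hw1, hw2, ?_, by omega⟩
  · rw [Set.disjoint_left]
    rintro v (rfl | rfl) hv
    · exact absurd (hpS' s (by omega) hv).1 (by omega)
    · exact absurd (hpS' t (by omega) hv).2 (by omega)
  · exact (Set.ncard_pair hne).le
  · ext x
    simp only [Set.mem_sdiff, Set.mem_iUnion, SimpleGraph.Subgraph.induce_verts,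
      SimpleGraph.mem_neighborSet, exists_prop]
    constructor
    · rintro ⟨⟨v, hv, hvx⟩, hx⟩
      by_cases hxo : x ∈ outer p N
      · exfalso
        rcases hv with ⟨i, hi1, hi2, rfl⟩ | ⟨hv1, ⟨i, hv2⟩, hv3⟩
        · have hxi : Attaches G p N x i := .of_adj hxo (by omega) hvx
          refine hx (.inr ⟨hxo, ⟨i, hxi⟩, fun j hj => ?_⟩)
          have hn := hnear x i j (by omega) (by omega) hxi hj
          constructor
          · by_contra! hlt
            exact hs x j i ⟨hj, hxi, hlt, hi1, hn.2⟩
          · by_contra! hlt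
            exact ht' x i j ⟨hxi, hj, hi2, hlt, hn.1⟩
        · have hr : (G.within (outer p N)).Adj v x := ⟨hvx, hv1, hxo⟩
          exact hx (.inr ⟨hxo, ⟨i, hv2.of_reachable hr.reachable⟩,
            fun j hj => hv3 j (hj.of_reachable hr.symm.reachable)⟩)
      · simp only [outer, Set.mem_ofPred_eq, not_forall, not_not] at hxo
        obtain ⟨j, hj, rfl⟩ := hxo
        have hsj : s ≤ j ∧ j ≤ t := by
          rcases hv with ⟨i, hi1, hi2, rfl⟩ | ⟨hv1, -, hv3⟩
          · have := (h.adj i (by omega) j hj).1 hvx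
            omega
          · exact hv3 j (.of_adj hv1 hj hvx.symm)
        have : j = s ∨ j = t := by
          by_contra! hcon
          exact hx (hpS j (by omega) (by omega))
        rcases this with rfl | rfl
        · exact .inl rfl
        · exact .inr rfl
    · rintro (rfl | rfl)
      · exact ⟨⟨y, hyS, hsy.symm⟩, fun hv => absurd (hpS' s (by omega) hv).1 (by omega)⟩
      · exact ⟨⟨z, hzS, htz.symm⟩, fun hv => absurd (hpS' t (by omega) hv).2 (by omega)⟩
  · rintro v (rfl | rfl)
    · rw [← Set.ncard_pair (hout hy (s + 1) (by omega))]
      refine Set.ncard_le_ncard ?_ (Set.toFinite _)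
      rintro v (rfl | rfl)
      · exact ⟨(h.adj _ (by omega) _ (by omega)).2 (.inl rfl), .inl (hpS _ (by omega) (by omega))⟩
      · exact ⟨hsy, .inl hyS⟩
    · rw [← Set.ncard_pair (hout hz (t - 1) (by omega))]
      refine Set.ncard_le_ncard ?_ (Set.toFinite _)
      rintro v (rfl | rfl)
      · exact ⟨(h.adj _ (by omega) _ (by omega)).2 (.inr (by omega)),
          .inl (hpS _ (by omega) (by omega))⟩
      · exact ⟨htz, .inl hzS⟩
  · intro v hv
    obtain ⟨i, h1, h2, rfl⟩ := hw3 v hv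
    rcases h1.eq_or_lt with rfl | h1
    · exact .inr (.inl rfl)
    rcases h2.eq_or_lt with rfl | h2
    · exact .inr (.inr rfl)
    exact .inl (hpS i h1 h2)

end

/-! ### Choice of constants and conclusion. -/

theorem mainTheorem4 (k m : ℕ) (hk : 1 ≤ k) (hm : 1 ≤ m) :
    ∃ c : ℕ, ∀ (V : Type*) [Fintype V] (G : SimpleGraph V) [DecidableRel G.Adj],
      3 ≤ G.minDegree → c ≤ treedepth G →
        ContainsProtectedFan G (m + k + 2) ∨
        (∃ G' : G.Subgraph, G'.IsInduced ∧
          IsLType G G' ((4 * k - 3) * (8 * k ^ 2 - 6 * k + 2 * m + 8) - 1) (m + k)) ∨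
        (subdividedH m 1 k k k).IsContained G := by
  -- `B` is the margin needed for a fan at either end. The windows start at `b₁` and `b₂`, each of
  -- width `2 * k * k`; the gap `m + 2 * k + 2` leaves `m + 2 * k` after both ends may have moved by
  -- one.
  set B := m * (2 * k + 1 + m) + 2 * m + 2 * k with hB
  set b₁ := B + 2 * k with hb₁
  set b₂ := b₁ + 2 * k * k + m + 2 * k + 2 with hb₂
  set hi := b₂ + 2 * k * k with hhi
  obtain ⟨M, hM⟩ := exists_inducedPath_or_biclique (hi + B) (m + 1 + 1 + k + k + k)
  refine ⟨M + 1, fun V _ G _ hmin htd => ?_⟩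
  by_contra! hcon
  obtain ⟨hF, hL, hH'⟩ := hcon
  have hH : ¬ (subdividedH m 1 k k k).IsContained G := not_nonempty_iff.2 hH'
  have hdeg : ∀ v a b, ∃ y, G.Adj v y ∧ y ≠ a ∧ y ≠ b := by
    classical
    intro v a b
    by_contra! hcon
    have h1 : G.neighborFinset v ⊆ {a, b} := by
      intro y hy
      rw [SimpleGraph.mem_neighborFinset] at hy
      simp only [Finset.mem_insert, Finset.mem_singleton]
      have := hcon y hy
      tauto
    have h2 := (Finset.card_le_card h1).trans Finset.card_le_two
    have h3 := G.minDegree_le_degree v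
    rw [SimpleGraph.card_neighborFinset_eq_degree] at h2
    omega
  obtain ⟨a, b, w, hw, hlen⟩ := exists_path_of_le_treedepth htd
  have hinj := hw.getVert_injOn
  obtain ⟨p, hp⟩ | ⟨u, v, hu, hv, huv⟩ := hM V G w.getVert
    (fun i hi j hj hij => hinj (show i ≤ _ by omega) (show j ≤ _ by omega) hij)
    (fun i hi => w.adj_getVert_succ (by omega))
  swap
  · exact hH (subdividedH_isContained_of_biclique hu hv huv)
  have hnear : ∀ x i j, B ≤ i → i ≤ hi → Attaches G p (hi + B) x i →
      Attaches G p (hi + B) x j → j < i + 2 * k ∧ i < j + 2 * k := fun x i j h1 h2 h3 h4 =>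
    hp.attaches_near hH hF hdeg hk hm h3 h4 h1 (by omega)
  obtain ⟨s₀, hs1, hs2, hs3⟩ := hp.exists_not_straddled hH hdeg hk hm (b₀ := b₁) (by omega) hnear
    (by omega) (by omega)
  obtain ⟨t₀, ht1, ht2, ht3⟩ := hp.exists_not_straddled hH hdeg hk hm (b₀ := b₂) (by omega) hnear
    (by omega) (by omega)
  obtain ⟨s, hs4, hs5, hs6, y, hy, hsy, hy'⟩ := hp.exists_left_end hdeg (by omega) hnear
    (by omega) (by omega) hs3
  obtain ⟨t, ht4, ht5, ht6, z, hz, htz, hz'⟩ := hp.exists_right_end hdeg (by omega) hnear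
    (by omega) (by omega) ht3
  -- The required bound is generous: the factor `4 * k - 3 ≥ 1` is simply dropped.
  have hbound : (t - s - 1) + (k - 1) ≤ (4 * k - 3) * (8 * k ^ 2 - 6 * k + 2 * m + 8) - 1 := by
    have h1 : t - s ≤ 4 * k * k + m + 2 * k + 2 := by
      have : 4 * k * k = 2 * k * k + 2 * k * k := by ring
      omega
    have h2 : 1 * (8 * k ^ 2 - 6 * k + 2 * m + 8) ≤
        (4 * k - 3) * (8 * k ^ 2 - 6 * k + 2 * m + 8) := Nat.mul_le_mul_right _ (by omega)
    have h3 : 4 * k * k + m + 3 * k + 1 + 6 * k ≤ 8 * k ^ 2 + 2 * m + 8 := by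
      nlinarith [sq_nonneg ((k : ℤ) - 1), sq_nonneg (4 * (k : ℤ) - 4)]
    omega
  exact hL _ ((SimpleGraph.Subgraph.isInduced_iff_exists_eq_induce_top _).2 ⟨_, rfl⟩) (hp.isLType_segment hH hdeg hk hm hnear
    (by omega) (by omega) (by omega) (by omega) (by omega) hs6 ht6 hy hsy hy' hz htz hz' hbound)
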